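/- Let $\lambda_b>0$, $P_b>0$, $\alpha>2$, $k>0$, $\gamma\ge 0$, and let $\sigma^2\ge 0$ be the noise power. Base stations (BSs) form a homogeneous Poisson point process $\Phi_b=\{b_i\}$ of intensity $\lambda_b$ in $\mathbb{R}^2$. The links from the BSs to the typical user equipment (UE), located at a fixed point $z\in\mathbb{R}^2$, have power gains $h_i$ that are i.i.d. exponential with mean $1$ and independent of $\Phi_b$. Put $r_{ci}=|b_i-z|$, let $c$ be the index of the BS nearest to $z$, and write $r_c=r_{cc}$ for its distance and $h_c$ for its gain. The UE is in cellular mode if $kP_bh_cr_c^{-\alpha}>\gamma$; let $\mathcal P$ be the probability of this event. The signal-to-interference-plus-noise ratio is $$\mathrm{SINR}_c=\frac{P_bh_cr_c^{-\alpha}}{\sum_{i\ne c}P_bh_ir_{ci}^{-\alpha}+\sigma^2}.$$ For $x>0$ let $\mathrm{SINR}_c(x)$ be a random variable distributed as $\mathrm{SINR}_c$ given $r_c=x$ (with no conditioning on the mode), and let $X$ be a random variable distributed as $r_c$ conditioned on cellular mode (the distance between a cellular UE and its serving BS). The average rate of a typical cellular UE is $$\mathcal R_c=\mathbb E_{X}\Big[\mathbb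 E_{\mathrm{SINR}_c}\big[\ln(1+\mathrm{SINR}_c(X))\big]\Big],$$ where the inner expectation is over the law of $\mathrm{SINR}_c(x)$ at $x=X$. Then $$\mathcal P=2\pi\lambda_b\int_0^\infty \exp\Big(-\frac{\gamma r^\alpha}{kP_b}-\pi\lambda_b r^2\Big)\,r\,dr ,$$ the average rate is finite, and $$\mathcal R_c=\mathbb E_{X}\Big[\int_0^\infty \mathbb P\big[\ln(1+\mathrm{SINR}_c(X))>t\big]\,dt\Big]$$ $$=\frac{2\pi\lambda_b}{\mathcal P}\int_0^\infty r\exp\Big(-\pi\lambda_b r^2-\frac{\gamma r^\alpha}{kP_b}\Big)\bigg(\int_0^\infty \exp\Big(-\frac{e^t-1}{P_b}r^\alpha\sigma^2\Big)\exp\Big(-2\pi\lambda_b\Big(\frac{e^t-1}{r^{-\alpha}}\Big)^{2/\alpha}L(e^t-1,\alpha)\Big)\,dt\bigg)dr,$$ where $L(\beta,\alpha)=\int_{\beta^{-1/\alpha}}^\infty \frac{u}{1+u^\alpha}\,du$ and the double integral converges absolutely. -/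

import Mathlib

open MeasureTheory ProbabilityTheory Set

namespace CellularD2D

noncomputable section

/-- The Euclidean plane. -/
abbrev Plane : Type := EuclideanSpace ℝ (Fin 2)

variable {Ω : Type*} [MeasurableSpace Ω]

/-- Number (with multiplicity, possibly infinite) of the points `b i ω` that lie in `A`. -/
def count (b : ℕ → Ω → Plane) (A : Set Plane) (ω : Ω) : ℕ∞ :=
  {i : ℕ | b i ω ∈ A}.encard

/-- The random points `b 0, b 1, …` form a homogeneous Poisson point process of intensity `lam` on
the plane: the number of points in a Borel set of finite area is Poisson distributed with mean
`lam` times the area, and the numbers of points in disjoint Borel sets are independent. -/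
structure IsPoissonProcess (b : ℕ → Ω → Plane) (lam : ℝ) (μ : Measure Ω) : Prop where
  measurable : ∀ i, Measurable (b i)
  hasLaw_count : ∀ A : Set Plane, MeasurableSet A → volume A ≠ ⊤ →
    HasLaw (count b A)
      ((poissonMeasure (lam.toNNReal * (volume A).toNNReal)).map (Nat.cast : ℕ → ℕ∞)) μ
  indep_count : ∀ (n : ℕ) (A : Fin n → Set Plane), (∀ j, MeasurableSet (A j)) →
    Pairwise (Function.onFun Disjoint A) → iIndepFun (fun j => count b (A j)) μ

/-- Rayleigh fading: the power gains `h i` of the links to the base stations are measurable,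
independent and exponentially distributed with mean one, and independent of the locations of the
base stations. -/
structure IsRayleighFading (h : ℕ → Ω → ℝ) (b : ℕ → Ω → Plane) (μ : Measure Ω) : Prop where
  measurable : ∀ i, Measurable (h i)
  hasLaw : ∀ i, HasLaw (h i) (expMeasure 1) μ
  indep : iIndepFun h μ
  indep_points : IndepFun (fun ω i => b i ω) (fun ω i => h i ω) μ

/-- Index of the base station nearest to the location `z` (the nearest one is almost surely unique
for a Poisson process; ties are broken by the index). -/
def nearest (b : ℕ → Ω → Plane) (z : Plane) (ω : Ω) : ℕ :=
  sInf {n : ℕ | ∀ i, dist (b n ω) z ≤ dist (b i ω) z}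

/-- Distance `r_c` from the user at `z` to its nearest base station. -/
def nearestDist (b : ℕ → Ω → Plane) (z : Plane) (ω : Ω) : ℝ :=
  dist (b (nearest b z ω) ω) z

/-- Power gain `h_c` of the link between the user at `z` and its nearest base station. -/
def nearestGain (b : ℕ → Ω → Plane) (h : ℕ → Ω → ℝ) (z : Plane) (ω : Ω) : ℝ :=
  h (nearest b z ω) ω

/-- Interference at `z`: total power received from all base stations but the nearest one, when each
transmits with power `P` and the path loss exponent is `α`. -/
def interference (b : ℕ → Ω → Plane) (h : ℕ → Ω → ℝ) (P α : ℝ) (z : Plane) (ω : Ω) : ℝ :=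
  ∑' i : ℕ, if i = nearest b z ω then 0 else P * h i ω * dist (b i ω) z ^ (-α)

/-- Signal-to-interference-plus-noise ratio of the user at `z` served by its nearest base station,
with noise power `σ ^ 2`. -/
def sinr (b : ℕ → Ω → Plane) (h : ℕ → Ω → ℝ) (P α σ : ℝ) (z : Plane) (ω : Ω) : ℝ :=
  P * nearestGain b h z ω * nearestDist b z ω ^ (-α) / (interference b h P α z ω + σ ^ 2)

/-- The event that the user at `z` chooses cellular mode: the biased power received from the nearest
base station exceeds the threshold `γ`. -/
def cellularMode (b : ℕ → Ω → Plane) (h : ℕ → Ω → ℝ) (P α k γ : ℝ) (z : Plane) : Set Ω :=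
  {ω | γ < k * P * nearestGain b h z ω * nearestDist b z ω ^ (-α)}

/-- Law of the distance between a cellular user and its serving base station: the law of the
distance to the nearest base station, conditioned on cellular mode. -/
def servingDistLaw (b : ℕ → Ω → Plane) (h : ℕ → Ω → ℝ) (P α k γ : ℝ) (z : Plane)
    (μ : Measure Ω) : Measure ℝ :=
  (ProbabilityTheory.cond μ (cellularMode b h P α k γ z)).map (nearestDist b z)

/-- Law of `SINR(x)`, the signal-to-interference-plus-noise ratio at a user whose nearest base
station is at distance `x`: the conditional distribution of the ratio given the distance to the
nearest base station. -/
def sinrLawAt (b : ℕ → Ω → Plane) (h : ℕ → Ω → ℝ) (P α σ : ℝ) (z : Plane)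
    (μ : Measure Ω) [IsFiniteMeasure μ] : Kernel ℝ ℝ :=
  condDistrib (sinr b h P α σ z) (nearestDist b z) μ

/-- Average rate `E_x[E_SINR[ln(1 + SINR(x))]]` of a cellular user, where `x` is the distance
between the cellular user and its serving base station. -/
def averageRate (b : ℕ → Ω → Plane) (h : ℕ → Ω → ℝ) (P α σ k γ : ℝ) (z : Plane)
    (μ : Measure Ω) [IsFiniteMeasure μ] : ℝ :=
  ∫ x, (∫ s, Real.log (1 + s) ∂(sinrLawAt b h P α σ z μ x)) ∂(servingDistLaw b h P α k γ z μ)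

/-- The function `L(β, α) = ∫_{β^{-1/α}}^∞ u / (1 + u^α) du`. -/
def L (β α : ℝ) : ℝ :=
  ∫ u in Ioi (β ^ (-(1 / α))), u / (1 + u ^ α)

end

end CellularD2D

namespace CellularD2D

open Filter Topology
open scoped ENNReal NNReal

/-! Put U_i = π λ |b_i - z|². These numbers form a Poisson process of rate one on the half-line. Fix
the locations: integrating out first the exponential gain of the nearest station c and then the
other gains shows that the event "h_c exceeds τ plus β times the relative interference" has
probability e^{-τ} times the product over i ≠ c of (1 + β (U_c / U_i)^{α/2})⁻¹. Every probability
needed is of this kind: β = 0 with a suitable τ gives cellular mode, and β = e^t - 1 with the noise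
in τ gives the tail of the rate.

It remains to average this product over the locations. Heuristically U_c has density e^{-x}, the
points beyond x are again Poisson, and their generating functional gives e^{-Cx} with C = `decayRate
β (α / 2)`. The proof never conditions on U_c. It weights the law of U_c by the product and squeezes
the mass of (x, x + δ] between δ exp(-(1 + C) x ± K δ): the half-line beyond x is cut into cells of
length δ, whose counts are independent Poisson variables, and the resulting sums are Riemann sums
for x C. A finite measure with such bounds has density e^{-(1 + C) x}
(`eq_withDensity_exp_of_Ioc_bounds`, `lintegral_nearest_mul_otherAttenuation`). Back in the radius r
this is `measure_nearestDist_inter_lt_gain`, and a substitution turns C into 2 β^{2/α} L(β, α).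

Integrating over sets of distances identifies the conditional law of the ratio given the distance,
and the layer cake formula gives the rate. Convergence holds because 1 + C is at least e^{2t/α} / 2
when β = e^t - 1, while the integral over r is at most inversely proportional to 1 + C. -/

/-! ### Mean and generating function of the Poisson law. -/

theorem lintegral_poissonMeasure (m : ℝ≥0) (f : ℕ → ℝ≥0∞) :
    ∫⁻ n, f n ∂(poissonMeasure m) =
      ∑' n : ℕ, ENNReal.ofReal (Real.exp (-m) * m ^ n / n.factorial) * f n := by
  rw [poissonMeasure, lintegral_sum_measure]
  simp [lintegral_smul_measure]

/-- Probability generating function of the Poisson distribution. -/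
theorem lintegral_pow_poissonMeasure (m : ℝ≥0) {s : ℝ} (hs : 0 ≤ s) :
    ∫⁻ n, ENNReal.ofReal s ^ n ∂(poissonMeasure m) =
      ENNReal.ofReal (Real.exp (-(m * (1 - s)))) := by
  have hsum : HasSum (fun n : ℕ => Real.exp (-m) * m ^ n / n.factorial * s ^ n)
      (Real.exp (-(m * (1 - s)))) := by
    have := (NormedSpace.expSeries_div_hasSum_exp ((m : ℝ) * s)).mul_left (Real.exp (-m))
    rw [← Real.exp_eq_exp_ℝ, ← Real.exp_add] at this
    convert! this using 1
    · ext n; rw [mul_pow]; ring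
    · congr 1; ring
  rw [lintegral_poissonMeasure, ← hsum.tsum_eq, ENNReal.ofReal_tsum_of_nonneg _ hsum.summable]
  · refine tsum_congr fun n => ?_
    rw [ENNReal.ofReal_mul (by positivity), ENNReal.ofReal_pow hs]
  · intro n; positivity

theorem lintegral_natCast_poissonMeasure (m : ℝ≥0) :
    ∫⁻ n, (n : ℝ≥0∞) ∂(poissonMeasure m) = m := by
  have hsum : HasSum (fun n : ℕ => Real.exp (-m) * m ^ n / n.factorial * n) m := by
    have h1 := (hasSum_one_poissonMeasure m).mul_left (m : ℝ)
    rw [mul_one] at h1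
    rw [← hasSum_nat_add_iff' 1]
    simp only [Finset.range_one, Finset.sum_singleton, Nat.cast_zero, mul_zero, sub_zero]
    convert! h1 using 1
    ext n
    rw [Nat.factorial_succ]
    push_cast
    have : (n.factorial : ℝ) ≠ 0 := by positivity
    have : (n : ℝ) + 1 ≠ 0 := by positivity
    field_simp
    ring
  have hm : (m : ℝ≥0∞) = ENNReal.ofReal (∑' n : ℕ, Real.exp (-m) * m ^ n / n.factorial * n) := by
    rw [hsum.tsum_eq, ENNReal.ofReal_coe_nnreal]
  rw [lintegral_poissonMeasure, hm, ENNReal.ofReal_tsum_of_nonneg _ hsum.summable]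
  · refine tsum_congr fun n => ?_
    rw [ENNReal.ofReal_mul (by positivity), ENNReal.ofReal_natCast]
  · intro n; positivity

/-! ### The attenuation factor and Riemann sums for its decay rate. -/

/-- Laplace transform of a mean one exponential gain, at the ratio `β * s ^ ρ`. -/
noncomputable def attenuation (β ρ s : ℝ) : ℝ := (1 + β * s ^ ρ)⁻¹

/-- Exponential decay rate of the expected product of attenuations. -/
noncomputable def decayRate (β ρ : ℝ) : ℝ := ∫ w in Ioi (1 : ℝ), (1 - attenuation β ρ w⁻¹)

section attenuation

variable {β ρ : ℝ}

theorem attenuation_pos (hβ : 0 ≤ β) {s : ℝ} (hs : 0 ≤ s) : 0 < attenuation β ρ s := by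
  have := Real.rpow_nonneg hs ρ
  unfold attenuation; positivity

theorem attenuation_le_one (hβ : 0 ≤ β) {s : ℝ} (hs : 0 ≤ s) : attenuation β ρ s ≤ 1 := by
  have := Real.rpow_nonneg hs ρ
  exact inv_le_one_of_one_le₀ (by nlinarith [mul_nonneg hβ this])

theorem attenuation_anti (hβ : 0 ≤ β) (hρ : 0 ≤ ρ) {s t : ℝ} (hs : 0 ≤ s) (hst : s ≤ t) :
    attenuation β ρ t ≤ attenuation β ρ s := by
  have h0 := Real.rpow_nonneg hs ρ
  have := Real.rpow_le_rpow hs hst hρ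
  unfold attenuation
  gcongr

theorem measurable_attenuation : Measurable (attenuation β ρ) := by
  unfold attenuation; fun_prop

/-- The integrand is dominated by β w^{-ρ}, which is where ρ > 1 (that is, α > 2) enters. -/
theorem integrableOn_one_sub_attenuation_inv (hβ : 0 ≤ β) (hρ : 1 < ρ) :
    IntegrableOn (fun w => 1 - attenuation β ρ w⁻¹) (Ioi 1) := by
  have h1 : IntegrableOn (fun w : ℝ => β * w ^ (-ρ)) (Ioi 1) :=
    (integrableOn_Ioi_rpow_of_lt (by linarith) one_pos).const_mul β
  refine h1.mono' ?_ ?_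
  · exact ((measurable_attenuation.comp measurable_inv).const_sub 1).aestronglyMeasurable
  · filter_upwards [self_mem_ae_restrict measurableSet_Ioi] with w hw
    have hw0 : (0 : ℝ) < w := one_pos.trans hw
    have hn := attenuation_le_one (ρ := ρ) hβ (inv_nonneg.2 hw0.le)
    rw [Real.norm_eq_abs, abs_of_nonneg (by linarith)]
    have hr := Real.rpow_nonneg (inv_nonneg.2 hw0.le) ρ
    have hx : w ^ (-ρ) = w⁻¹ ^ ρ := by rw [Real.rpow_neg hw0.le, Real.inv_rpow hw0.le]
    rw [hx, attenuation]
    have hp : 0 < 1 + β * w⁻¹ ^ ρ := by positivity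
    have : 1 - (1 + β * w⁻¹ ^ ρ)⁻¹ = β * w⁻¹ ^ ρ * (1 + β * w⁻¹ ^ ρ)⁻¹ := by field_simp; ring
    rw [this]
    refine mul_le_of_le_one_right (by positivity) hn

theorem decayRate_nonneg (hβ : 0 ≤ β) : 0 ≤ decayRate β ρ := by
  refine setIntegral_nonneg measurableSet_Ioi fun w hw => ?_
  have := attenuation_le_one (ρ := ρ) hβ (inv_nonneg.2 (one_pos.trans hw).le)
  linarith

/-- The substitution w = 1 + s δ / x. It explains why sums over cells of length δ are compared with
x times a constant that does not depend on x. -/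
theorem integral_one_sub_attenuation_grid {x δ : ℝ} (hx : 0 < x) (hδ : 0 < δ) (n : ℕ) :
    δ * ∫ s in (0 : ℝ)..n, (1 - attenuation β ρ (x / (x + s * δ))) =
      x * ∫ w in (1 : ℝ)..(1 + δ / x * n), (1 - attenuation β ρ w⁻¹) := by
  have := intervalIntegral.integral_comp_add_mul (a := 0) (b := n)
    (fun w => 1 - attenuation β ρ w⁻¹) (c := δ / x) (by positivity) 1
  rw [mul_zero, add_zero, smul_eq_mul] at this
  have h2 : ∀ s, x / (x + s * δ) = (1 + δ / x * s)⁻¹ := by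
    intro s
    have : 1 + δ / x * s = (x + s * δ) / x := by field_simp
    rw [this, inv_div]
  simp_rw [h2]
  rw [this]
  field_simp

theorem antitoneOn_grid (hβ : 0 ≤ β) (hρ : 0 ≤ ρ) {x δ : ℝ} (hx : 0 < x) (hδ : 0 < δ) :
    AntitoneOn (fun s => 1 - attenuation β ρ (x / (x + s * δ))) (Ici 0) := by
  intro a ha b hb hab
  rw [mem_Ici] at ha hb
  have h1 : 0 < x + a * δ := by positivity
  have h2 : x + a * δ ≤ x + b * δ := by gcongr
  have := attenuation_anti hβ hρ (s := x / (x + b * δ)) (t := x / (x + a * δ))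
    (by positivity) (by gcongr)
  simp only; linarith

/-- Each term after the first is bounded by the integral over the preceding unit interval, by
monotonicity; the term j = 0 is at most δ and accounts for the extra summand. -/
theorem sum_grid_le_decayRate (hβ : 0 ≤ β) (hρ : 1 < ρ) {y δ : ℝ} (hy : 0 < y) (hδ : 0 < δ)
    (J : ℕ) :
    ∑ j ∈ Finset.range J, δ * (1 - attenuation β ρ (y / (y + j * δ))) ≤
      δ + y * decayRate β ρ := by
  set φ : ℝ → ℝ := fun s => 1 - attenuation β ρ (y / (y + s * δ)) with hφ
  have hanti : AntitoneOn φ (Ici 0) := antitoneOn_grid hβ (by linarith) hy hδ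
  have hφ0 : ∀ s : ℝ, 0 ≤ s → 0 ≤ φ s := fun s hs => by
    have := attenuation_le_one (ρ := ρ) hβ (s := y / (y + s * δ)) (by positivity)
    simp only [hφ]; linarith
  have hφ1 : ∀ s : ℝ, 0 ≤ s → φ s ≤ 1 := fun s hs => by
    have := attenuation_pos (ρ := ρ) hβ (s := y / (y + s * δ)) (by positivity)
    simp only [hφ]; linarith
  have h1 : ∑ j ∈ Finset.range J, φ j ≤ 1 + ∑ j ∈ Finset.range J, φ (0 + (j + 1 : ℕ)) := by
    have h2 := Finset.sum_range_succ' (fun j : ℕ => φ j) J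
    rw [Finset.sum_range_succ] at h2
    have := hφ1 0 le_rfl
    have h3 := hφ0 J (by positivity)
    simp only [zero_add]
    simp only [Nat.cast_zero] at h2
    linarith
  have h2 : ∑ j ∈ Finset.range J, φ (0 + (j + 1 : ℕ)) ≤ ∫ s in (0 : ℝ)..(0 + J), φ s :=
    AntitoneOn.sum_le_integral (hanti.mono Icc_subset_Ici_self)
  have h3 := integral_one_sub_attenuation_grid (β := β) (ρ := ρ) hy hδ J
  have h4 : ∫ w in (1 : ℝ)..(1 + δ / y * J), (1 - attenuation β ρ w⁻¹) ≤ decayRate β ρ := by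
    rw [intervalIntegral.integral_of_le (le_add_of_nonneg_right (by positivity))]
    refine setIntegral_mono_set (integrableOn_one_sub_attenuation_inv hβ hρ) ?_
      (LE.le.eventuallyLE Ioc_subset_Ioi_self)
    filter_upwards [self_mem_ae_restrict measurableSet_Ioi] with w hw
    have := attenuation_le_one (ρ := ρ) hβ (inv_nonneg.2 (one_pos.trans hw).le)
    simp only [Pi.zero_apply]
    linarith
  rw [zero_add] at h2
  rw [← Finset.mul_sum]
  calc δ * ∑ j ∈ Finset.range J, φ j ≤ δ * (1 + ∫ s in (0 : ℝ)..J, φ s) := by gcongr; linarith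
    _ = δ + y * ∫ w in (1 : ℝ)..(1 + δ / y * J), (1 - attenuation β ρ w⁻¹) := by
        rw [mul_add, mul_one, h3]
    _ ≤ _ := by gcongr

/-- The index shift by 2 discards two terms of a sum that dominates the integral, each at most δ,
whence 2δ. The error ε comes from truncating the improper integral. -/
theorem exists_decayRate_le_sum_grid (hβ : 0 ≤ β) (hρ : 1 < ρ) {x δ : ℝ} (hx : 0 ≤ x)
    (hδ : 0 < δ) {ε : ℝ} (hε : 0 < ε) :
    ∃ J : ℕ, x * decayRate β ρ - 2 * δ - ε ≤
      ∑ j ∈ Finset.range J, δ * (1 - attenuation β ρ (x / (x + (j + 2 : ℕ) * δ))) := by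
  -- At x = 0 the rescaling by δ / x is unavailable, but the left side is already negative, so the
  -- empty sum does.
  rcases hx.eq_or_lt with rfl | hx
  · exact ⟨0, by simp; linarith⟩
  set φ : ℝ → ℝ := fun s => 1 - attenuation β ρ (x / (x + s * δ)) with hφ
  have hanti : AntitoneOn φ (Ici 0) := antitoneOn_grid hβ (by linarith) hx hδ
  have hφ1 : ∀ s : ℝ, 0 ≤ s → φ s ≤ 1 := fun s hs => by
    have := attenuation_pos (ρ := ρ) hβ (s := x / (x + s * δ)) (by positivity)
    simp only [hφ]; linarith
  have hlim : Tendsto (fun n : ℕ => x * ∫ w in (1 : ℝ)..(1 + δ / x * (n + 2 : ℕ)),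
      (1 - attenuation β ρ w⁻¹)) atTop (𝓝 (x * decayRate β ρ)) := by
    refine Tendsto.const_mul _ (intervalIntegral_tendsto_integral_Ioi 1
      (integrableOn_one_sub_attenuation_inv hβ hρ) ?_)
    refine tendsto_atTop_add_const_left _ _ (Tendsto.const_mul_atTop (by positivity) ?_)
    exact tendsto_natCast_atTop_atTop.comp (tendsto_add_atTop_nat 2)
  obtain ⟨J, hJ⟩ := (hlim.eventually (lt_mem_nhds (sub_lt_self _ hε))).exists
  refine ⟨J, ?_⟩
  rw [← integral_one_sub_attenuation_grid hx hδ] at hJ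
  have h2 : ∫ s in (0 : ℝ)..(0 + (J + 2 : ℕ)), φ s ≤
      ∑ j ∈ Finset.range (J + 2), φ (0 + j) :=
    AntitoneOn.integral_le_sum (hanti.mono Icc_subset_Ici_self)
  rw [Finset.sum_range_succ', Finset.sum_range_succ'] at h2
  have h3 := hφ1 (0 + (0 : ℕ)) (by simp)
  have h4 := hφ1 (0 + (0 + 1 : ℕ)) (by simp)
  simp only [zero_add] at h2 h3 h4
  rw [← Finset.mul_sum]
  change _ ≤ δ * ∑ j ∈ Finset.range J, φ (j + 2 : ℕ)
  have h5 : δ * ∫ s in (0 : ℝ)..(J + 2 : ℕ), φ s ≤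
      δ * (∑ j ∈ Finset.range J, φ (j + 2 : ℕ) + 2) := by
    gcongr
    refine h2.trans ?_
    have : ∑ j ∈ Finset.range J, φ (j + 1 + 1 : ℕ) = ∑ j ∈ Finset.range J, φ (j + 2 : ℕ) := rfl
    linarith
  linarith

end attenuation

/-! ### Recovering a measure from its mass on short intervals. -/

/-- A finite measure on the positive half-line whose mass on short intervals is asymptotically
`exp (-a x)` times their length is the measure with that density. -/
theorem eq_withDensity_exp_of_Ioc_bounds (ν : Measure ℝ) [IsFiniteMeasure ν] (hν : ν (Iic 0) = 0)
    {a K : ℝ} (ha : 0 ≤ a) (hK : 0 ≤ K)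
    (hlo : ∀ x δ, 0 ≤ x → 0 < δ →
      ENNReal.ofReal (δ * Real.exp (-(a * x) - K * δ)) ≤ ν (Ioc x (x + δ)))
    (hup : ∀ x δ, 0 ≤ x → 0 < δ →
      ν (Ioc x (x + δ)) ≤ ENNReal.ofReal (δ * Real.exp (-(a * x) + K * δ))) :
    ν = (volume.restrict (Ioi 0)).withDensity fun x => ENNReal.ofReal (Real.exp (-(a * x))) := by
  set G : ℝ → ℝ := fun x => ν.real (Iic x) with hG
  have hdiff : ∀ x δ, 0 ≤ x → 0 < δ → G (x + δ) - G x = ν.real (Ioc x (x + δ)) := by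
    intro x δ _ hδ
    have h := measureReal_union (μ := ν)
      (Set.disjoint_left.2 fun y (hy : y ∈ Iic x) (hy' : y ∈ Ioc x (x + δ)) => not_lt.2 hy hy'.1)
      measurableSet_Ioc
    rw [Iic_union_Ioc_eq_Iic (le_add_of_nonneg_right hδ.le)] at h
    simp only [hG, h, add_sub_cancel_left]
  have hlo' : ∀ x δ, 0 ≤ x → 0 < δ →
      δ * Real.exp (-(a * x) - K * δ) ≤ G (x + δ) - G x := by
    intro x δ hx hδ
    rw [hdiff x δ hx hδ]
    exact (ENNReal.ofReal_le_iff_le_toReal (measure_ne_top _ _)).1 (hlo x δ hx hδ)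
  have hup' : ∀ x δ, 0 ≤ x → 0 < δ →
      G (x + δ) - G x ≤ δ * Real.exp (-(a * x) + K * δ) := by
    intro x δ hx hδ
    rw [hdiff x δ hx hδ]
    exact ENNReal.toReal_le_of_le_ofReal (by positivity) (hup x δ hx hδ)
  have hmono : Monotone G := fun x y hxy => measureReal_mono (Iic_subset_Iic.2 hxy)
  have hcont : ∀ b, 0 ≤ b → ContinuousOn G (Icc 0 b) := by
    intro b hb
    have hle : ∀ x ∈ Icc 0 b, ∀ y ∈ Icc 0 b, x ≤ y →
        dist (G x) (G y) ≤ (Real.exp (K * b)) * dist x y := by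
      intro x hx y hy hxy
      rcases hxy.eq_or_lt with rfl | hlt
      · simp
      have h1 := hup' x (y - x) hx.1 (sub_pos.2 hlt)
      rw [add_sub_cancel] at h1
      rw [Real.dist_eq, Real.dist_eq, abs_sub_comm, abs_of_nonneg (sub_nonneg.2 (hmono hxy)),
        abs_sub_comm, abs_of_nonneg (sub_nonneg.2 hxy), mul_comm]
      refine h1.trans (mul_le_mul_of_nonneg_left (Real.exp_le_exp.2 ?_) (sub_nonneg.2 hxy))
      have := mul_nonneg ha hx.1
      have : K * (y - x) ≤ K * b := mul_le_mul_of_nonneg_left (by linarith [hx.1, hy.2]) hK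
      linarith
    have : LipschitzOnWith (Real.toNNReal (Real.exp (K * b))) G (Icc 0 b) := by
      refine LipschitzOnWith.of_dist_le_mul fun x hx y hy => ?_
      rw [Real.coe_toNNReal _ (Real.exp_pos _).le]
      rcases le_total x y with h | h
      · exact hle x hx y hy h
      · rw [dist_comm, dist_comm x y]; exact hle y hy x hx h
    exact this.continuousOn
  -- The bounds squeeze only forward difference quotients, so just the right derivative of the
  -- distribution function is obtained. With the continuity above, this suffices for the fundamental
  -- theorem of calculus.
  have hderiv : ∀ x, 0 ≤ x → HasDerivWithinAt G (Real.exp (-(a * x))) (Ioi x) x := by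
    intro x hx
    rw [hasDerivWithinAt_iff_tendsto_slope' (self_notMem_Ioi (a := x))]
    have hl : Tendsto (fun y => Real.exp (-(a * x) - K * (y - x))) (𝓝[>] x)
        (𝓝 (Real.exp (-(a * x)))) := by
      have : Continuous fun y => Real.exp (-(a * x) - K * (y - x)) := by fun_prop
      simpa using (this.tendsto x).mono_left nhdsWithin_le_nhds
    have hr : Tendsto (fun y => Real.exp (-(a * x) + K * (y - x))) (𝓝[>] x)
        (𝓝 (Real.exp (-(a * x)))) := by
      have : Continuous fun y => Real.exp (-(a * x) + K * (y - x)) := by fun_prop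
      simpa using (this.tendsto x).mono_left nhdsWithin_le_nhds
    refine tendsto_of_tendsto_of_tendsto_of_le_of_le' hl hr ?_ ?_
    · filter_upwards [self_mem_nhdsWithin] with y hy
      have hp : 0 < y - x := sub_pos.2 hy
      have := hlo' x (y - x) hx hp
      rw [add_sub_cancel] at this
      rw [slope_def_field, le_div_iff₀ hp, mul_comm]
      exact this
    · filter_upwards [self_mem_nhdsWithin] with y hy
      have hp : 0 < y - x := sub_pos.2 hy
      have := hup' x (y - x) hx hp
      rw [add_sub_cancel] at this
      rw [slope_def_field, div_le_iff₀ hp, mul_comm]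
      exact this
  have hcexp : Continuous fun y => Real.exp (-(a * y)) := by fun_prop
  refine Measure.ext_of_Iic _ _ fun b => ?_
  rw [withDensity_apply _ measurableSet_Iic, Measure.restrict_restrict measurableSet_Iic]
  rcases le_or_gt b 0 with hb | hb
  · have h1 : Iic b ∩ Ioi 0 = ∅ := by
      ext y; simp only [mem_inter_iff, mem_Iic, mem_Ioi, mem_empty_iff_false, iff_false]
      intro h; linarith
    rw [h1, measure_mono_null (Iic_subset_Iic.2 hb) hν]; simp
  · have h1 : Iic b ∩ Ioi 0 = Ioc 0 b := by ext y; simp [and_comm]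
    have h2 : ∫ y in (0 : ℝ)..b, Real.exp (-(a * y)) = G b - G 0 := by
      refine intervalIntegral.integral_eq_sub_of_hasDeriv_right ?_ ?_
        (hcexp.intervalIntegrable _ _)
      · rw [uIcc_of_le hb.le]; exact hcont b hb.le
      · intro x hx
        rw [min_eq_left hb.le] at hx
        exact hderiv x hx.1.le
    have h3 : G 0 = 0 := by simp [hG, measureReal_def, hν]
    rw [h3, sub_zero, intervalIntegral.integral_of_le hb.le] at h2
    rw [h1, ← ofReal_integral_eq_lintegral_ofReal, h2]
    · simp [hG]
    · exact (hcexp.integrableOn_Icc (a := 0) (b := b)).mono_set Ioc_subset_Icc_self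
    · exact Eventually.of_forall fun y => (Real.exp_pos _).le

/-! ### Products over a configuration, compared cell by cell. -/

/-- Product of the attenuations of all points of the configuration `v` but the one with index `c`,
relative to the latter. -/
noncomputable def otherAttenuation (β ρ : ℝ) (v : ℕ → ℝ) (c : ℕ) : ℝ≥0∞ :=
  ⨅ n : ℕ, ∏ i ∈ Finset.range n,
    if i = c then 1 else ENNReal.ofReal (attenuation β ρ (v c / v i))

/-- The cells of a monotone sequence are disjoint, so at most one factor can differ from 1. -/
theorem prod_cells_eq {t : ℕ → ℝ} (ht : Monotone t) (g : ℕ → ℝ≥0∞) (w : ℝ) (J : ℕ) :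
    (∃ j < J, w ∈ Ioc (t j) (t (j + 1)) ∧
      ∏ j ∈ Finset.range J, (if w ∈ Ioc (t j) (t (j + 1)) then g j else 1) = g j) ∨
    (∀ j < J, w ∉ Ioc (t j) (t (j + 1))) ∧
      ∏ j ∈ Finset.range J, (if w ∈ Ioc (t j) (t (j + 1)) then g j else 1) = 1 := by
  by_cases h : ∃ j < J, w ∈ Ioc (t j) (t (j + 1))
  · left
    obtain ⟨j, hj, hw⟩ := h
    refine ⟨j, hj, hw, ?_⟩
    rw [Finset.prod_eq_single j]
    · simp only [if_pos hw]
    · intro k _ hkj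
      rw [if_neg]
      intro hk
      rcases lt_or_gt_of_ne hkj with hlt | hlt
      · exact absurd (hk.2.trans (ht hlt)) (not_le.2 hw.1)
      · exact absurd (hw.2.trans (ht hlt)) (not_le.2 hk.1)
    · intro hj'; exact absurd (Finset.mem_range.2 hj) hj'
  · right
    push Not at h
    exact ⟨h, Finset.prod_eq_one fun j hj => if_neg (h j (Finset.mem_range.1 hj))⟩

/-- Converts a product over points into a power of a count. The bound n lies beyond every index of a
point up to b, so the count is finite and `toNat` loses nothing. -/
theorem prod_range_cell_eq_pow (v : ℕ → ℝ) (a b : ℝ) (g : ℝ≥0∞) {n : ℕ}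
    (hn : ∀ i, v i ≤ b → i < n) :
    ∏ i ∈ Finset.range n, (if v i ∈ Ioc a b then g else 1) =
      g ^ ({i | v i ∈ Ioc a b}.encard).toNat := by
  have : {i | v i ∈ Ioc a b} = ((Finset.range n).filter fun i => v i ∈ Ioc a b : Finset ℕ) := by
    ext i
    simp only [mem_ofPred_eq, Finset.coe_filter, Finset.mem_range]
    exact ⟨fun h => ⟨hn i h.2, h⟩, fun h => h.2⟩
  rw [this, Set.encard_coe_eq_coe_finsetCard, ENat.toNat_natCast, ← Finset.prod_filter,
    Finset.prod_const]

theorem exists_forall_lt_of_finite {s : Set ℕ} (hs : s.Finite) : ∃ n, ∀ i ∈ s, i < n := by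
  obtain ⟨n, hn⟩ := hs.bddAbove
  exact ⟨n + 1, fun i hi => Nat.lt_succ_of_le (hn hi)⟩

/-- A point in cell j has v c / v i ≥ x / t (j + 1), so its factor is at most the one for the right
endpoint. Points outside the J cells may be dropped since their factors are at most 1; hence
finitely many cells suffice. The point c lies in no cell because v c ≤ t 0. -/
theorem otherAttenuation_le_prod {β ρ : ℝ} (hβ : 0 ≤ β) (hρ : 0 ≤ ρ) {v : ℕ → ℝ}
    (hv : ∀ i, 0 < v i) (hfin : ∀ T, {i | v i ≤ T}.Finite) {c : ℕ} {x : ℝ} (hx : 0 ≤ x)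
    {t : ℕ → ℝ} (ht : Monotone t) (hxc : x < v c) (hct : v c ≤ t 0) (J : ℕ) :
    otherAttenuation β ρ v c ≤ ∏ j ∈ Finset.range J,
      ENNReal.ofReal (attenuation β ρ (x / t (j + 1))) ^
        ({i | v i ∈ Ioc (t j) (t (j + 1))}.encard).toNat := by
  obtain ⟨n, hn⟩ := exists_forall_lt_of_finite (hfin (t J))
  have h1 : ∀ j ∈ Finset.range J, ENNReal.ofReal (attenuation β ρ (x / t (j + 1))) ^
        ({i | v i ∈ Ioc (t j) (t (j + 1))}.encard).toNat =
      ∏ i ∈ Finset.range n, (if v i ∈ Ioc (t j) (t (j + 1)) then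
        ENNReal.ofReal (attenuation β ρ (x / t (j + 1))) else 1) := fun j hj =>
    (prod_range_cell_eq_pow v _ _ _ fun i hi =>
      hn i (hi.trans (ht (Nat.succ_le_of_lt (Finset.mem_range.1 hj))))).symm
  rw [Finset.prod_congr rfl h1, Finset.prod_comm]
  refine (iInf_le _ n).trans (Finset.prod_le_prod' fun i _ => ?_)
  have hle : ∀ i, ENNReal.ofReal (attenuation β ρ (v c / v i)) ≤ 1 := fun i =>
    ENNReal.ofReal_le_one.2 (attenuation_le_one hβ (div_nonneg (hv c).le (hv i).le))
  rcases prod_cells_eq ht (fun j => ENNReal.ofReal (attenuation β ρ (x / t (j + 1)))) (v i) J with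
    ⟨j, _, hw, heq⟩ | ⟨_, heq⟩
  · rw [heq]
    have hic : i ≠ c := by
      rintro rfl
      exact absurd (hct.trans (ht (Nat.zero_le j))) (not_le.2 hw.1)
    rw [if_neg hic]
    have := (hv i).trans_le hw.2
    refine ENNReal.ofReal_le_ofReal (attenuation_anti hβ hρ (by positivity) ?_)
    exact div_le_div₀ (hv c).le hxc.le (hv i) hw.2
  · rw [heq]
    split_ifs
    · exact le_rfl
    · exact hle i

theorem exists_mem_cell {t : ℕ → ℝ} {w : ℝ} {J : ℕ} (h0 : t 0 < w) (hJ : w ≤ t J) :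
    ∃ j < J, w ∈ Ioc (t j) (t (j + 1)) := by
  induction J with
  | zero => exact absurd hJ (not_le.2 h0)
  | succ J ih =>
    rcases le_or_gt w (t J) with h | h
    · obtain ⟨j, hj, hw⟩ := ih h
      exact ⟨j, hj.trans (Nat.lt_succ_self J), hw⟩
    · exact ⟨J, Nat.lt_succ_self J, h, hJ⟩

/-- Here left endpoints are used, with v c ≤ t 0. No point other than c may be missed, so all of
them must lie beyond t 0 and J has to run to infinity; surplus points in the cells only make the
left side smaller. -/
theorem iInf_prod_le_otherAttenuation {β ρ : ℝ} (hβ : 0 ≤ β) (hρ : 0 ≤ ρ) {v : ℕ → ℝ}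
    (hv : ∀ i, 0 < v i) (hfin : ∀ T, {i | v i ≤ T}.Finite) {c : ℕ}
    {t : ℕ → ℝ} (ht : Monotone t) (httop : Tendsto t atTop atTop) (hct : v c ≤ t 0)
    (hother : ∀ i, i ≠ c → t 0 < v i) :
    ⨅ J : ℕ, ∏ j ∈ Finset.range J, ENNReal.ofReal (attenuation β ρ (t 0 / t j)) ^
        ({i | v i ∈ Ioc (t j) (t (j + 1))}.encard).toNat ≤ otherAttenuation β ρ v c := by
  have ht0 : 0 < t 0 := (hv c).trans_le hct
  refine le_iInf fun n => ?_
  obtain ⟨J, hJ⟩ : ∃ J, ∀ i ∈ Finset.range n, v i ≤ t J := by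
    have : ∀ᶠ J in atTop, ∀ i ∈ Finset.range n, v i ≤ t J :=
      (Finset.eventually_all _).2 fun i _ => httop.eventually_ge_atTop (v i)
    exact this.exists
  obtain ⟨m, hm⟩ := exists_forall_lt_of_finite (hfin (t J))
  have h1 : ∀ j ∈ Finset.range J, ENNReal.ofReal (attenuation β ρ (t 0 / t j)) ^
        ({i | v i ∈ Ioc (t j) (t (j + 1))}.encard).toNat =
      ∏ i ∈ Finset.range m, (if v i ∈ Ioc (t j) (t (j + 1)) then
        ENNReal.ofReal (attenuation β ρ (t 0 / t j)) else 1) := fun j hj =>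
    (prod_range_cell_eq_pow v _ _ _ fun i hi =>
      hm i (hi.trans (ht (Nat.succ_le_of_lt (Finset.mem_range.1 hj))))).symm
  have htj : ∀ j, 0 < t j := fun j => ht0.trans_le (ht (Nat.zero_le j))
  have hle : ∀ j, ENNReal.ofReal (attenuation β ρ (t 0 / t j)) ≤ 1 := fun j =>
    ENNReal.ofReal_le_one.2 (attenuation_le_one hβ (div_nonneg ht0.le (htj j).le))
  refine (iInf_le _ J).trans ?_
  rw [Finset.prod_congr rfl h1, Finset.prod_comm]
  have hnm : Finset.range n ⊆ Finset.range m := fun i hi =>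
    Finset.mem_range.2 (hm i (hJ i hi))
  have hle1 : ∀ i, ∏ j ∈ Finset.range J, (if v i ∈ Ioc (t j) (t (j + 1)) then
      ENNReal.ofReal (attenuation β ρ (t 0 / t j)) else 1) ≤ 1 := fun i =>
    Finset.prod_le_one' fun j _ => by split_ifs; exacts [hle j, le_rfl]
  refine (Finset.prod_le_prod_of_subset_of_le_one' hnm fun i _ _ => hle1 i).trans
    (Finset.prod_le_prod' fun i hi => ?_)
  by_cases hic : i = c
  · rw [if_pos hic]; exact hle1 i
  · rw [if_neg hic]
    rcases prod_cells_eq ht (fun j => ENNReal.ofReal (attenuation β ρ (t 0 / t j))) (v i) J with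
      ⟨j, _, hw, heq⟩ | ⟨hno, _⟩
    · rw [heq]
      refine ENNReal.ofReal_le_ofReal (attenuation_anti hβ hρ
        (div_nonneg (hv c).le (hv i).le) ?_)
      exact div_le_div₀ ht0.le hct (htj j) hw.1.le
    · obtain ⟨j, hj, hw⟩ := exists_mem_cell (hother i hic) (hJ i hi)
      exact absurd hw (hno j hj)

theorem otherAttenuation_le_one {β ρ : ℝ} (v : ℕ → ℝ) (c : ℕ) : otherAttenuation β ρ v c ≤ 1 :=
  (iInf_le _ 0).trans (by simp)

/-! ### Rate-one Poisson processes on the half-line. -/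

/-- Number of the points `u i ω` that lie in the interval `(a, b]`. -/
noncomputable def countIoc {Ω : Type*} (u : ℕ → Ω → ℝ) (a b : ℝ) (ω : Ω) : ℕ∞ :=
  {i : ℕ | u i ω ∈ Ioc a b}.encard

theorem countIoc_eq_tsum {Ω : Type*} (u : ℕ → Ω → ℝ) (a b : ℝ) (ω : Ω) :
    (countIoc u a b ω : ℝ≥0∞) = ∑' i, (Ioc a b).indicator (fun _ => (1 : ℝ≥0∞)) (u i ω) := by
  rw [countIoc, ← ENNReal.tsum_set_one, tsum_subtype {i | u i ω ∈ Ioc a b} fun _ => (1 : ℝ≥0∞)]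
  rfl

/-- The random points `u 0, u 1, …` form a Poisson process of rate one on the positive half-line. -/
structure IsUnitRatePoisson {Ω : Type*} [MeasurableSpace Ω] (u : ℕ → Ω → ℝ) (μ : Measure Ω) :
    Prop where
  measurable : ∀ i, Measurable (u i)
  pos : ∀ᵐ ω ∂μ, ∀ i, 0 < u i ω
  hasLaw_count : ∀ a b, 0 ≤ a → a ≤ b →
    HasLaw (countIoc u a b) ((poissonMeasure (b - a).toNNReal).map (Nat.cast : ℕ → ℕ∞)) μ
  indep_count : ∀ t : ℕ → ℝ, Monotone t → 0 ≤ t 0 → ∀ n : ℕ,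
    iIndepFun (fun j : Fin n => countIoc u (t j) (t (j + 1))) μ

namespace IsUnitRatePoisson

variable {Ω : Type*} [MeasurableSpace Ω] {μ : Measure Ω} {u : ℕ → Ω → ℝ}

theorem measurable_countIoc (hu : IsUnitRatePoisson u μ) (a b : ℝ) :
    Measurable (countIoc u a b) := by
  have h : Measurable fun ω => (countIoc u a b ω : ℝ≥0∞) := by
    simp_rw [countIoc_eq_tsum]
    exact Measurable.tsum fun i =>
      (measurable_const.indicator measurableSet_Ioc).comp (hu.measurable i)
  refine measurable_to_countable' fun k => ?_
  have : countIoc u a b ⁻¹' {k} = (fun ω => (countIoc u a b ω : ℝ≥0∞)) ⁻¹' {(k : ℝ≥0∞)} := by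
    ext ω; simp
  rw [this]
  exact h (measurableSet_singleton _)

theorem lintegral_count (hu : IsUnitRatePoisson u μ) {a b : ℝ} (ha : 0 ≤ a) (hab : a ≤ b)
    (φ : ℕ∞ → ℝ≥0∞) :
    ∫⁻ ω, φ (countIoc u a b ω) ∂μ = ∫⁻ k : ℕ, φ k ∂(poissonMeasure (b - a).toNNReal) := by
  rw [(hu.hasLaw_count a b ha hab).lintegral_comp .of_discrete,
    lintegral_map .of_discrete .of_discrete]

/-- Independence of the counts in consecutive cells, in the form used below: expectations of
products factor. -/
theorem lintegral_prod_count (hu : IsUnitRatePoisson u μ) {t : ℕ → ℝ} (ht : Monotone t)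
    (ht0 : 0 ≤ t 0) (φ : ℕ → ℕ∞ → ℝ≥0∞) (n : ℕ) :
    ∫⁻ ω, ∏ j ∈ Finset.range n, φ j (countIoc u (t j) (t (j + 1)) ω) ∂μ =
      ∏ j ∈ Finset.range n, ∫⁻ k : ℕ, φ j k ∂(poissonMeasure (t (j + 1) - t j).toNNReal) := by
  have h1 := (hu.indep_count t ht ht0 n).comp (fun j : Fin n => φ j) fun j => .of_discrete
  have h2 := lintegral_prod_eq_prod_lintegral_of_indepFun Finset.univ _ h1 fun j =>
    Measurable.of_discrete.comp (hu.measurable_countIoc _ _)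
  simp only [Function.comp_apply] at h2
  rw [← Fin.prod_univ_eq_prod_range
    (fun j => ∫⁻ k : ℕ, φ j k ∂(poissonMeasure (t (j + 1) - t j).toNNReal)) n]
  calc _ = ∫⁻ ω, ∏ j : Fin n, φ j (countIoc u (t j) (t (j + 1)) ω) ∂μ :=
        lintegral_congr fun ω => (Fin.prod_univ_eq_prod_range
          (fun j => φ j (countIoc u (t j) (t (j + 1)) ω)) n).symm
    _ = _ := by
        rw [h2]
        exact Finset.prod_congr rfl fun j _ =>
          hu.lintegral_count (ht0.trans (ht (Nat.zero_le _))) (ht (Nat.le_succ _)) _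

theorem ae_finite (hu : IsUnitRatePoisson u μ) : ∀ᵐ ω ∂μ, ∀ T, {i | u i ω ≤ T}.Finite := by
  have h1 : ∀ᵐ ω ∂μ, ∀ m : ℕ, countIoc u 0 m ω ≠ ⊤ := by
    refine ae_all_iff.2 fun m => ?_
    refine ((hu.hasLaw_count 0 m le_rfl (by positivity)).ae_iff (p := fun k => k ≠ ⊤)
      .of_discrete).2 ?_
    rw [ae_map_iff .of_discrete .of_discrete]
    exact Eventually.of_forall fun k => ENat.natCast_ne_top k
  filter_upwards [h1, hu.pos] with ω hω hpos T
  obtain ⟨m, hm⟩ := exists_nat_ge T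
  have := hω m
  rw [countIoc, Ne, Set.encard_eq_top_iff, not_infinite] at this
  exact this.subset fun i hi => ⟨hpos i, (show u i ω ≤ T from hi).trans hm⟩

/-- Campbell's bound: negative powers above one of the points are almost surely summable. -/
theorem ae_summable_rpow_neg (hu : IsUnitRatePoisson u μ) {ρ : ℝ} (hρ : 1 < ρ) :
    ∀ᵐ ω ∂μ, Summable fun i => u i ω ^ (-ρ) := by
  have hmeas : ∀ j : ℕ, Measurable fun ω =>
      ENNReal.ofReal ((j + 1 : ℝ) ^ (-ρ)) * (countIoc u (j + 1) (j + 2) ω : ℝ≥0∞) := fun j =>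
    (Measurable.of_discrete (f := fun k : ℕ∞ => (k : ℝ≥0∞))).comp
      (hu.measurable_countIoc _ _) |>.const_mul _
  -- The points in (j + 1, j + 2] contribute at most (j + 1)^{-ρ} each, and their expected number is
  -- one, so the expected bound is a convergent p-series.
  have hint : ∫⁻ ω, ∑' j : ℕ, ENNReal.ofReal ((j + 1 : ℝ) ^ (-ρ)) *
      (countIoc u (j + 1) (j + 2) ω : ℝ≥0∞) ∂μ ≠ ⊤ := by
    rw [lintegral_tsum fun j => (hmeas j).aemeasurable]
    have hone : ∀ j : ℕ, ∫⁻ ω, ENNReal.ofReal ((j + 1 : ℝ) ^ (-ρ)) *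
        (countIoc u (j + 1) (j + 2) ω : ℝ≥0∞) ∂μ = ENNReal.ofReal ((j + 1 : ℝ) ^ (-ρ)) := by
      intro j
      have h2 := hu.lintegral_count (a := j + 1) (b := j + 2) (by positivity) (by linarith)
        fun k => (k : ℝ≥0∞)
      simp only [ENat.toENNReal_coe] at h2
      rw [lintegral_const_mul' _ _ ENNReal.ofReal_ne_top, h2, lintegral_natCast_poissonMeasure]
      have : (j + 2 - (j + 1) : ℝ) = 1 := by ring
      simp [this]
    simp_rw [hone]
    have hs : Summable fun j : ℕ => (j + 1 : ℝ) ^ (-ρ) := by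
      have := (summable_nat_add_iff 1).2 (Real.summable_nat_rpow.2 (by linarith : -ρ < -1))
      simpa using this
    exact hs.tsum_ofReal_ne_top
  have hfin := ae_lt_top (Measurable.tsum hmeas) hint
  filter_upwards [hfin, hu.ae_finite, hu.pos] with ω hω hloc hpos
  have hs1 : Summable fun i => (if 1 < u i ω then u i ω ^ (-ρ) else 0) := by
    have hnn : ∀ i, 0 ≤ (if 1 < u i ω then u i ω ^ (-ρ) else 0) := fun i => by
      split_ifs
      exacts [Real.rpow_nonneg (hpos i).le _, le_rfl]
    have hlt : ∑' i, ENNReal.ofReal (if 1 < u i ω then u i ω ^ (-ρ) else 0) ≠ ⊤ := by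
      refine ne_top_of_le_ne_top hω.ne ?_
      simp_rw [countIoc_eq_tsum, ← ENNReal.tsum_mul_left]
      rw [ENNReal.tsum_comm]
      refine ENNReal.tsum_le_tsum fun i => ?_
      split_ifs with h
      · obtain ⟨J, hJ⟩ := exists_nat_ge (u i ω)
        obtain ⟨j, _, hw⟩ := exists_mem_cell (t := fun j : ℕ => (j + 1 : ℝ)) (w := u i ω) (J := J)
          (by simpa using h) (by linarith)
        have hw' : u i ω ∈ Ioc (j + 1 : ℝ) (j + 2) := by
          refine ⟨hw.1, hw.2.trans (le_of_eq ?_)⟩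
          push_cast; ring
        refine le_trans ?_ (ENNReal.le_tsum j)
        rw [indicator_of_mem hw', mul_one]
        exact ENNReal.ofReal_le_ofReal
          (Real.rpow_le_rpow_of_nonpos (by positivity) hw.1.le (by linarith))
      · simp
    have := ENNReal.summable_toReal hlt
    refine this.congr fun i => ?_
    rw [ENNReal.toReal_ofReal (hnn i)]
  -- Only finitely many points lie in (0, 1], so these large terms cannot spoil summability.
  have hs2 : Summable fun i => (if 1 < u i ω then 0 else u i ω ^ (-ρ)) :=
    summable_of_hasFiniteSupport ((hloc 1).subset fun i hi => by
      by_contra hcon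
      have : 1 < u i ω := not_le.1 hcon
      exact hi (by simp [this]))
  refine (hs1.add hs2).congr fun i => ?_
  split_ifs <;> simp

end IsUnitRatePoisson

/-! ### The law of the nearest point, weighted by the attenuation of the others. -/

/-- The grid `0, x, x + δ, x + 2 δ, …`. -/
noncomputable def grid (x δ : ℝ) : ℕ → ℝ
  | 0 => 0
  | j + 1 => x + j * δ

theorem monotone_grid {x δ : ℝ} (hx : 0 ≤ x) (hδ : 0 ≤ δ) : Monotone (grid x δ) := by
  refine monotone_nat_of_le_succ fun j => ?_
  cases j with
  | zero => simpa [grid] using hx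
  | succ j =>
    simp only [grid]
    push_cast
    nlinarith

namespace IsUnitRatePoisson

variable {Ω : Type*} [MeasurableSpace Ω] {μ : Measure Ω} {u : ℕ → Ω → ℝ} {c : Ω → ℕ} {β ρ : ℝ}

theorem lintegral_prod_grid (hu : IsUnitRatePoisson u μ) {x δ : ℝ} (hx : 0 ≤ x) (hδ : 0 < δ)
    (ψ : ℕ∞ → ℝ≥0∞) {g : ℕ → ℝ} (hg : ∀ j, 0 ≤ g j) (J : ℕ) :
    ∫⁻ ω, (if countIoc u 0 x ω = 0 then 1 else 0) * ψ (countIoc u x (x + δ) ω) *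
      ∏ j ∈ Finset.range J, ENNReal.ofReal (g j) ^
        (countIoc u (x + (j + 1 : ℕ) * δ) (x + (j + 2 : ℕ) * δ) ω).toNat ∂μ =
    ENNReal.ofReal (Real.exp (-x)) * (∫⁻ k : ℕ, ψ k ∂(poissonMeasure δ.toNNReal)) *
      ENNReal.ofReal (Real.exp (-∑ j ∈ Finset.range J, δ * (1 - g j))) := by
  -- Cell 0 is (0, x] and must be empty, cell 1 is (x, x + δ] and carries ψ, and each later cell of
  -- length δ contributes its generating function.
  set φ : ℕ → ℕ∞ → ℝ≥0∞ := fun j => match j with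
    | 0 => fun k => if k = 0 then 1 else 0
    | 1 => ψ
    | j + 2 => fun k => ENNReal.ofReal (g j) ^ k.toNat with hφ
  have h := hu.lintegral_prod_count (monotone_grid hx hδ.le) le_rfl φ (J + 2)
  simp only [Finset.prod_range_succ', hφ, grid, Nat.cast_zero, zero_mul, add_zero, zero_add,
    Nat.cast_one, one_mul, sub_zero, add_sub_cancel_left, ENat.toNat_natCast] at h
  have h0 : ∫⁻ k : ℕ, (if (k : ℕ∞) = 0 then 1 else 0) ∂(poissonMeasure x.toNNReal) =
      ENNReal.ofReal (Real.exp (-x)) := by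
    rw [lintegral_poissonMeasure, tsum_eq_single 0]
    · simp [Real.coe_toNNReal x hx]
    · intro k hk; simp [hk]
  have hprod : ∏ j ∈ Finset.range J, ∫⁻ k : ℕ, ENNReal.ofReal (g j) ^ k
      ∂(poissonMeasure (x + ((j + 1 + 1 : ℕ) : ℝ) * δ - (x + ((j + 1 : ℕ) : ℝ) * δ)).toNNReal) =
      ENNReal.ofReal (Real.exp (-∑ j ∈ Finset.range J, δ * (1 - g j))) := by
    rw [← Finset.sum_neg_distrib, Real.exp_sum,
      ENNReal.ofReal_prod_of_nonneg fun j _ => (Real.exp_pos _).le]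
    refine Finset.prod_congr rfl fun j _ => ?_
    have h1 : x + ((j + 1 + 1 : ℕ) : ℝ) * δ - (x + ((j + 1 : ℕ) : ℝ) * δ) = δ := by
      push_cast; ring
    rw [h1, lintegral_pow_poissonMeasure _ (hg j), Real.coe_toNNReal _ hδ.le]
  rw [h0, hprod] at h
  calc _ = _ := lintegral_congr fun ω => by ring
    _ = _ := h
    _ = _ := by ring

/-- If the nearest point lies in (x, x + δ], then (0, x] is empty and (x, x + δ] is not; the latter
has probability at most its mean δ. In the exponent, 2δ comes from the shifted Riemann sum and δ
from choosing ε = δ. -/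
theorem lintegral_otherAttenuation_le (hu : IsUnitRatePoisson u μ)
    (hc : ∀ᵐ ω ∂μ, ∀ i, u (c ω) ω ≤ u i ω) (hβ : 0 ≤ β) (hρ : 1 < ρ) {x δ : ℝ} (hx : 0 ≤ x)
    (hδ : 0 < δ) :
    ∫⁻ ω, (Ioc x (x + δ)).indicator 1 (u (c ω) ω) *
      otherAttenuation β ρ (fun i => u i ω) (c ω) ∂μ ≤
    ENNReal.ofReal (δ * Real.exp (-((1 + decayRate β ρ) * x) + 3 * δ)) := by
  obtain ⟨J, hJ⟩ := exists_decayRate_le_sum_grid hβ hρ hx hδ hδ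
  set g : ℕ → ℝ := fun j => attenuation β ρ (x / (x + (j + 2 : ℕ) * δ)) with hgdef
  have hg : ∀ j, 0 ≤ g j := fun j => (attenuation_pos hβ (by positivity)).le
  have hkey := hu.lintegral_prod_grid hx hδ (fun k => if k = 0 then 0 else 1) hg J
  have hle : ∫⁻ k : ℕ, (if (k : ℕ∞) = 0 then 0 else 1) ∂(poissonMeasure δ.toNNReal) ≤
      ENNReal.ofReal δ := by
    refine le_trans (lintegral_mono fun k => ?_)
      (lintegral_natCast_poissonMeasure δ.toNNReal).le
    rcases Nat.eq_zero_or_pos k with rfl | hk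
    · simp
    · simp only [Nat.cast_eq_zero, hk.ne', if_false]
      exact_mod_cast hk
  calc _ ≤ ∫⁻ ω, (if countIoc u 0 x ω = 0 then 1 else 0) *
        (if countIoc u x (x + δ) ω = 0 then 0 else 1) *
        ∏ j ∈ Finset.range J, ENNReal.ofReal (g j) ^
          (countIoc u (x + (j + 1 : ℕ) * δ) (x + (j + 2 : ℕ) * δ) ω).toNat ∂μ := by
        refine lintegral_mono_ae ?_
        filter_upwards [hc, hu.pos, hu.ae_finite] with ω hcω hpos hfin
        by_cases hU : u (c ω) ω ∈ Ioc x (x + δ)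
        · rw [indicator_of_mem hU, Pi.one_apply, one_mul, if_pos, if_neg, one_mul, one_mul]
          · refine otherAttenuation_le_prod hβ (by linarith) hpos hfin hx
              (t := fun j => x + (j + 1 : ℕ) * δ) ?_ hU.1 ?_ J
            · intro a b hab
              have : (a : ℝ) ≤ b := by exact_mod_cast hab
              simp only
              push_cast
              nlinarith
            · simpa using hU.2
          · rw [countIoc, Set.encard_eq_zero, ← Ne, ← nonempty_iff_ne_empty]
            exact ⟨c ω, hU⟩
          · rw [countIoc, Set.encard_eq_zero, eq_empty_iff_forall_notMem]
            intro i hi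
            exact absurd (hU.1.trans_le (hcω i)) (not_lt.2 hi.2)
        · rw [indicator_of_notMem hU, zero_mul]
          exact zero_le
    _ ≤ ENNReal.ofReal (Real.exp (-x)) * ENNReal.ofReal δ *
        ENNReal.ofReal (Real.exp (-∑ j ∈ Finset.range J, δ * (1 - g j))) := by
        rw [hkey]
        gcongr
    _ ≤ _ := by
        rw [← ENNReal.ofReal_mul (Real.exp_pos _).le, ← ENNReal.ofReal_mul (by positivity),
          mul_comm (Real.exp _) δ, mul_assoc, ← Real.exp_add]
        refine ENNReal.ofReal_le_ofReal (mul_le_mul_of_nonneg_left (Real.exp_le_exp.2 ?_) hδ.le)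
        linarith

/-- Restrict to the event that (0, x] is empty and (x, x + δ] holds exactly one point: that point is
the nearest, and all others lie beyond x + δ. The event costs e^{-x} δ e^{-δ}, and the Riemann sum
at x + δ costs δ + (x + δ) C in the exponent. -/
theorem le_lintegral_otherAttenuation [IsProbabilityMeasure μ] (hu : IsUnitRatePoisson u μ)
    (hc : ∀ᵐ ω ∂μ, ∀ i, u (c ω) ω ≤ u i ω) (hβ : 0 ≤ β) (hρ : 1 < ρ) {x δ : ℝ} (hx : 0 ≤ x)
    (hδ : 0 < δ) :
    ENNReal.ofReal (δ * Real.exp (-((1 + decayRate β ρ) * x) - (2 + decayRate β ρ) * δ)) ≤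
    ∫⁻ ω, (Ioc x (x + δ)).indicator 1 (u (c ω) ω) *
      otherAttenuation β ρ (fun i => u i ω) (c ω) ∂μ := by
  have hy : 0 < x + δ := by positivity
  set g : ℕ → ℝ := fun j => attenuation β ρ ((x + δ) / (x + (j + 1 : ℕ) * δ)) with hgdef
  have hg : ∀ j, 0 ≤ g j := fun j => (attenuation_pos hβ (by positivity)).le
  have hg1 : ∀ j, g j ≤ 1 := fun j => attenuation_le_one hβ (by positivity)
  have hkey := hu.lintegral_prod_grid hx hδ (fun k => if k = 1 then 1 else 0) hg
  have hone : ∫⁻ k : ℕ, (if (k : ℕ∞) = 1 then 1 else 0) ∂(poissonMeasure δ.toNNReal) =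
      ENNReal.ofReal (Real.exp (-δ) * δ) := by
    rw [lintegral_poissonMeasure, tsum_eq_single 1]
    · simp [Real.coe_toNNReal δ hδ.le]
    · intro k hk; simp [hk]
  set F : ℕ → Ω → ℝ≥0∞ := fun J ω => (if countIoc u 0 x ω = 0 then 1 else 0) *
        (if countIoc u x (x + δ) ω = 1 then 1 else 0) *
        ∏ j ∈ Finset.range J, ENNReal.ofReal (g j) ^
          (countIoc u (x + (j + 1 : ℕ) * δ) (x + (j + 2 : ℕ) * δ) ω).toNat with hF
  have hFm : ∀ J, Measurable (F J) := fun J => by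
    refine Measurable.mul (Measurable.mul ?_ ?_) ?_
    · exact (Measurable.of_discrete (f := fun k : ℕ∞ => if k = 0 then (1 : ℝ≥0∞) else 0)).comp
        (hu.measurable_countIoc _ _)
    · exact (Measurable.of_discrete (f := fun k : ℕ∞ => if k = 1 then (1 : ℝ≥0∞) else 0)).comp
        (hu.measurable_countIoc _ _)
    · exact Finset.measurable_fun_prod _ fun j _ =>
        (Measurable.of_discrete (f := fun k : ℕ∞ => ENNReal.ofReal (g j) ^ k.toNat)).comp
          (hu.measurable_countIoc _ _)
  have hFanti : Antitone F := by
    refine antitone_nat_of_succ_le fun J ω => ?_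
    simp only [hF, Finset.prod_range_succ]
    gcongr
    exact mul_le_of_le_one_right' (pow_le_one' (ENNReal.ofReal_le_one.2 (hg1 J)) _)
  have hbound : ∀ J, ENNReal.ofReal
      (δ * Real.exp (-((1 + decayRate β ρ) * x) - (2 + decayRate β ρ) * δ)) ≤ ∫⁻ ω, F J ω ∂μ := by
    intro J
    rw [hkey J, hone, ← ENNReal.ofReal_mul (Real.exp_pos _).le,
      ← ENNReal.ofReal_mul (by positivity)]
    refine ENNReal.ofReal_le_ofReal ?_
    have hs := sum_grid_le_decayRate hβ hρ hy hδ J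
    have hs' : ∑ j ∈ Finset.range J, δ * (1 - g j) ≤ δ + (x + δ) * decayRate β ρ := by
      refine le_trans (le_of_eq (Finset.sum_congr rfl fun j _ => ?_)) hs
      have : x + ((j + 1 : ℕ) : ℝ) * δ = x + δ + j * δ := by push_cast; ring
      simp only [hgdef, this]
    have : Real.exp (-x) * (Real.exp (-δ) * δ) *
        Real.exp (-∑ j ∈ Finset.range J, δ * (1 - g j)) =
        δ * Real.exp (-x + -δ + -∑ j ∈ Finset.range J, δ * (1 - g j)) := by
      rw [Real.exp_add, Real.exp_add]; ring
    rw [this]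
    refine mul_le_mul_of_nonneg_left (Real.exp_le_exp.2 ?_) hδ.le
    linarith
  have hfin0 : ∫⁻ ω, F 0 ω ∂μ ≠ ⊤ := by
    refine ne_top_of_le_ne_top ENNReal.one_ne_top ?_
    calc ∫⁻ ω, F 0 ω ∂μ ≤ ∫⁻ _, 1 ∂μ := by
          refine lintegral_mono fun ω => ?_
          simp only [hF, Finset.range_zero, Finset.prod_empty, mul_one]
          split_ifs <;> simp
      _ = 1 := by simp
  -- The bound is uniform in the number J of cells, so monotone convergence carries it to the
  -- infinite product.
  refine (le_iInf hbound).trans ?_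
  rw [← lintegral_iInf hFm hFanti hfin0]
  refine lintegral_mono_ae ?_
  filter_upwards [hc, hu.pos, hu.ae_finite] with ω hcω hpos hfin
  by_cases h0 : countIoc u 0 x ω = 0
  swap
  · exact (iInf_le _ 0).trans (by simp [hF, h0])
  by_cases h1 : countIoc u x (x + δ) ω = 1
  swap
  · exact (iInf_le _ 0).trans (by simp [hF, h1])
  have hxlt : ∀ i, x < u i ω := by
    intro i
    by_contra hcon
    rw [countIoc, Set.encard_eq_zero, eq_empty_iff_forall_notMem] at h0
    exact h0 i ⟨hpos i, not_lt.1 hcon⟩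
  obtain ⟨i₀, hi₀⟩ := Set.encard_eq_one.1 h1
  have hmem : u i₀ ω ∈ Ioc x (x + δ) := by
    have : i₀ ∈ {i | u i ω ∈ Ioc x (x + δ)} := by rw [hi₀]; rfl
    exact this
  have hcm : u (c ω) ω ∈ Ioc x (x + δ) := ⟨hxlt _, (hcω i₀).trans hmem.2⟩
  have hci : c ω = i₀ := by
    have : c ω ∈ {i | u i ω ∈ Ioc x (x + δ)} := hcm
    rw [hi₀] at this
    exact this
  have hother : ∀ i, i ≠ c ω → x + δ < u i ω := by
    intro i hi
    by_contra hcon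
    have : i ∈ {i | u i ω ∈ Ioc x (x + δ)} := ⟨hxlt i, not_lt.1 hcon⟩
    rw [hi₀] at this
    exact hi (this.trans hci.symm)
  rw [indicator_of_mem hcm, Pi.one_apply, one_mul]
  have hmono : Monotone fun j : ℕ => x + ((j + 1 : ℕ) : ℝ) * δ := by
    intro a b hab
    have : (a : ℝ) ≤ b := by exact_mod_cast hab
    simp only
    push_cast
    nlinarith
  have htop : Tendsto (fun j : ℕ => x + ((j + 1 : ℕ) : ℝ) * δ) atTop atTop :=
    tendsto_atTop_add_const_left _ _ (Tendsto.atTop_mul_const hδ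
      (tendsto_natCast_atTop_atTop.comp (tendsto_add_atTop_nat 1)))
  have := iInf_prod_le_otherAttenuation hβ (by linarith : 0 ≤ ρ) hpos hfin hmono htop
    (c := c ω) (by simpa using hcm.2) (by simpa using hother)
  refine le_trans (iInf_mono fun J => ?_) this
  simp only [hF, h0, h1, if_true, one_mul, hgdef]
  simp [countIoc, add_assoc]

/-- The left side is the integral of f against the law ν of the nearest point under the measure
weighted by the product. The two preceding bounds determine ν; K = 3 + C covers both error terms 3δ
and (2 + C) δ. -/
theorem lintegral_nearest_mul_otherAttenuation [IsProbabilityMeasure μ] (hu : IsUnitRatePoisson u μ)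
    (hcm : Measurable c) (hc : ∀ᵐ ω ∂μ, ∀ i, u (c ω) ω ≤ u i ω) (hβ : 0 ≤ β) (hρ : 1 < ρ)
    {f : ℝ → ℝ≥0∞} (hf : Measurable f) :
    ∫⁻ ω, f (u (c ω) ω) * otherAttenuation β ρ (fun i => u i ω) (c ω) ∂μ =
      ∫⁻ x in Ioi 0, f x * ENNReal.ofReal (Real.exp (-((1 + decayRate β ρ) * x))) := by
  have hpair : Measurable fun ω => (c ω, fun i => u i ω) :=
    hcm.prodMk (measurable_pi_lambda _ hu.measurable)
  have hU : Measurable fun ω => u (c ω) ω := by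
    have : Measurable fun p : ℕ × (ℕ → ℝ) => p.2 p.1 :=
      measurable_from_prod_countable_right fun n => measurable_pi_apply n
    exact this.comp hpair
  set V : Ω → ℝ≥0∞ := fun ω => otherAttenuation β ρ (fun i => u i ω) (c ω) with hV
  have hVm : Measurable V := by
    refine Measurable.iInf fun n => Finset.measurable_fun_prod _ fun i _ => ?_
    refine Measurable.ite (hcm (measurableSet_singleton i) |> fun h => ?_) measurable_const ?_
    · convert h using 1
      ext ω; exact eq_comm
    · exact (measurable_attenuation.comp (hU.div (hu.measurable i))).ennreal_ofReal
  set ν : Measure ℝ := (μ.withDensity V).map fun ω => u (c ω) ω with hν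
  have hVfin : ∫⁻ ω, V ω ∂μ ≠ ⊤ := by
    refine ne_top_of_le_ne_top ENNReal.one_ne_top
      ((lintegral_mono fun ω => otherAttenuation_le_one _ _).trans ?_)
    simp
  have : IsFiniteMeasure (μ.withDensity V) := isFiniteMeasure_withDensity hVfin
  have hlint : ∀ f : ℝ → ℝ≥0∞, Measurable f → ∫⁻ x, f x ∂ν = ∫⁻ ω, f (u (c ω) ω) * V ω ∂μ := by
    intro f hf
    rw [hν, lintegral_map hf hU, lintegral_withDensity_eq_lintegral_mul _ hVm
      (show Measurable fun ω => f (u (c ω) ω) from hf.comp hU)]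
    exact lintegral_congr fun ω => by simp [mul_comm]
  have hIoc : ∀ x δ, ν (Ioc x (x + δ)) =
      ∫⁻ ω, (Ioc x (x + δ)).indicator 1 (u (c ω) ω) * V ω ∂μ := by
    intro x δ
    rw [← hlint _ (measurable_one.indicator measurableSet_Ioc),
      lintegral_indicator_one measurableSet_Ioc]
  have hC : 0 ≤ decayRate β ρ := decayRate_nonneg hβ
  have hmain := eq_withDensity_exp_of_Ioc_bounds ν (a := 1 + decayRate β ρ)
    (K := 3 + decayRate β ρ) ?_ (by linarith) (by linarith) ?_ ?_
  · change ∫⁻ ω, f (u (c ω) ω) * V ω ∂μ = _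
    rw [← hlint f hf, hmain, lintegral_withDensity_eq_lintegral_mul _ (by fun_prop) hf]
    exact lintegral_congr fun x => by simp [mul_comm]
  · rw [← lintegral_indicator_one measurableSet_Iic,
      hlint _ (measurable_one.indicator measurableSet_Iic)]
    refine (lintegral_congr_ae ?_).trans lintegral_zero
    filter_upwards [hu.pos] with ω hω
    rw [indicator_of_notMem (notMem_Iic.2 (hω _)), zero_mul]
  · intro x δ hx hδ
    rw [hIoc]
    refine le_trans (ENNReal.ofReal_le_ofReal ?_) (hu.le_lintegral_otherAttenuation hc hβ hρ hx hδ)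
    refine mul_le_mul_of_nonneg_left (Real.exp_le_exp.2 ?_) hδ.le
    linarith
  · intro x δ hx hδ
    rw [hIoc]
    refine (hu.lintegral_otherAttenuation_le hc hβ hρ hx hδ).trans (ENNReal.ofReal_le_ofReal ?_)
    refine mul_le_mul_of_nonneg_left (Real.exp_le_exp.2 ?_) hδ.le
    have := mul_nonneg hC hδ.le
    linarith

end IsUnitRatePoisson

/-! ### Exponential gains with the locations held fixed. -/

theorem expMeasure_one_Ioi {y : ℝ} (hy : 0 ≤ y) :
    expMeasure 1 (Ioi y) = ENNReal.ofReal (Real.exp (-y)) := by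
  have := isProbabilityMeasure_expMeasure one_pos
  have h := cdf_expMeasure_eq one_pos y
  rw [if_pos hy, one_mul, cdf_eq_real] at h
  rw [← compl_Iic, prob_compl_eq_one_sub measurableSet_Iic, ← ofReal_measureReal, h,
    ← ENNReal.ofReal_one, ← ENNReal.ofReal_sub _ (by simpa using hy)]
  congr 1; ring

theorem lintegral_exp_neg_mul_expMeasure_one {a : ℝ} (ha : 0 ≤ a) :
    ∫⁻ x, ENNReal.ofReal (Real.exp (-(a * x))) ∂(expMeasure 1) = ENNReal.ofReal (1 + a)⁻¹ := by
  have hm : ∀ r, Measurable (exponentialPDF r) := fun r =>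
    (measurable_exponentialPDFReal r).ennreal_ofReal
  have h1 : expMeasure 1 = volume.withDensity (exponentialPDF 1) := rfl
  rw [h1, lintegral_withDensity_eq_lintegral_mul _ (hm 1) (by fun_prop)]
  -- Tilting the rate-one density by e^{-ax} gives 1 / (1 + a) times the density of rate 1 + a,
  -- whose mass is one.
  have h2 : ∀ x, (exponentialPDF 1 * fun x => ENNReal.ofReal (Real.exp (-(a * x)))) x =
      ENNReal.ofReal (1 + a)⁻¹ * exponentialPDF (1 + a) x := by
    intro x
    rw [Pi.mul_apply, exponentialPDF_eq, exponentialPDF_eq]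
    split_ifs
    · rw [← ENNReal.ofReal_mul (by positivity), ← ENNReal.ofReal_mul (by positivity), one_mul,
        ← Real.exp_add, ← mul_assoc, inv_mul_cancel₀ (by positivity), one_mul]
      ring_nf
    · simp
  simp_rw [h2]
  rw [lintegral_const_mul _ (hm _), lintegral_exponentialPDF_eq_one (by positivity), mul_one]

/-- The σ-algebra is left free so that the lemma also applies to the one generated by the gains with
index different from c. -/
theorem measurable_tsum_ite {Ω : Type*} {m : MeasurableSpace Ω} {f : ℕ → Ω → ℝ} (c : ℕ)
    (hf : ∀ i, i ≠ c → Measurable (f i)) :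
    Measurable fun ω => ∑' i, if i = c then 0 else f i ω := by
  refine Measurable.tsum fun i => ?_
  split_ifs with hic
  · exact measurable_const
  · exact hf i hic

section fading

variable {Ω : Type*} [MeasurableSpace Ω] {μ : Measure Ω}
  {h : ℕ → Ω → ℝ}

theorem ae_gain_pos (hl : ∀ i, HasLaw (h i) (expMeasure 1) μ) : ∀ᵐ ω ∂μ, ∀ i, 0 < h i ω := by
  refine ae_all_iff.2 fun i => ?_
  refine ((hl i).ae_iff (p := fun x => 0 < x) measurableSet_Ioi.mem).2 ?_
  have := isProbabilityMeasure_expMeasure one_pos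
  have h1 := expMeasure_one_Ioi le_rfl
  rw [neg_zero, Real.exp_zero, ENNReal.ofReal_one] at h1
  exact (prob_compl_eq_zero_iff measurableSet_Ioi).2 h1

/-- The gains have mean at most one, so the expected sum is at most the sum of the weights, hence
finite. -/
theorem ae_summable_mul_gain (hl : ∀ i, HasLaw (h i) (expMeasure 1) μ) {a : ℕ → ℝ}
    (ha : ∀ i, 0 ≤ a i) (hs : Summable a) : ∀ᵐ ω ∂μ, Summable fun i => a i * h i ω := by
  have hmean : ∀ i, ∫⁻ ω, ENNReal.ofReal (h i ω) ∂μ ≤ 1 := by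
    intro i
    have h0 : 0 ≤ᵐ[μ] h i := by
      filter_upwards [ae_gain_pos hl] with ω hω using (hω i).le
    rw [lintegral_eq_lintegral_meas_lt μ h0 (hl i).aemeasurable]
    have hcongr : ∀ t ∈ Ioi (0 : ℝ), μ {ω | t < h i ω} = ENNReal.ofReal (Real.exp (-t)) := by
      intro t ht
      rw [← expMeasure_one_Ioi (le_of_lt ht)]
      exact (hl i).measure_eq (p := fun x => t < x) measurableSet_Ioi
    rw [setLIntegral_congr_fun measurableSet_Ioi hcongr,
      ← ofReal_integral_eq_lintegral_ofReal (integrableOn_exp_neg_Ioi 0)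
        (Eventually.of_forall fun _ => (Real.exp_pos _).le), integral_exp_neg_Ioi_zero]
    simp
  have hm : ∀ i, AEMeasurable (fun ω => ENNReal.ofReal (a i * h i ω)) μ := fun i =>
    ((hl i).aemeasurable.const_mul _).ennreal_ofReal
  have hint : ∫⁻ ω, ∑' i, ENNReal.ofReal (a i * h i ω) ∂μ ≠ ⊤ := by
    rw [lintegral_tsum hm]
    refine ne_top_of_le_ne_top hs.tsum_ofReal_ne_top (ENNReal.tsum_le_tsum fun i => ?_)
    simp_rw [ENNReal.ofReal_mul (ha i)]
    rw [lintegral_const_mul' _ _ ENNReal.ofReal_ne_top]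
    exact mul_le_of_le_one_right' (hmean i)
  filter_upwards [ae_lt_top' (AEMeasurable.tsum hm) hint, ae_gain_pos hl] with ω hω hpos
  refine (ENNReal.summable_toReal hω.ne).congr fun i => ?_
  rw [ENNReal.toReal_ofReal (mul_nonneg (ha i) (hpos i).le)]

theorem indepFun_gain_sum [IsProbabilityMeasure μ] (hm : ∀ i, Measurable (h i))
    (hi : iIndepFun h μ) (a : ℕ → ℝ) (c : ℕ) :
    IndepFun (h c) (fun ω => ∑' i, if i = c then 0 else a i * h i ω) μ := by
  have h1 := indep_iSup_of_disjoint (fun i => (hm i).comap_le) hi.iIndep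
    (disjoint_compl_right (a := ({c} : Set ℕ)))
  rw [IndepFun_iff_Indep]
  refine indep_of_indep_of_le_right (indep_of_indep_of_le_left h1 ?_) ?_
  · simp
  · refine Measurable.comap_le ?_
    refine measurable_tsum_ite c fun i hic => ?_
    refine Measurable.const_mul ?_ _
    exact (comap_measurable (h i)).mono (le_iSup₂_of_le i hic le_rfl) le_rfl

theorem tsum_ite_nonneg {f : ℕ → ℝ} (hf : ∀ i, 0 ≤ f i) (c : ℕ) :
    0 ≤ ∑' i, if i = c then 0 else f i :=
  tsum_nonneg fun i => by split_ifs; exacts [le_rfl, hf i]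

/-- The probability that an exponential gain exceeds an independent weighted sum of gains. -/
theorem measure_tsum_lt_gain [IsProbabilityMeasure μ] (hm : ∀ i, Measurable (h i))
    (hl : ∀ i, HasLaw (h i) (expMeasure 1) μ) (hi : iIndepFun h μ) {a : ℕ → ℝ}
    (ha : ∀ i, 0 ≤ a i) (hs : Summable a) (c : ℕ) {τ : ℝ} (hτ : 0 ≤ τ) :
    μ {ω | τ + (∑' i, if i = c then 0 else a i * h i ω) < h c ω} =
      ENNReal.ofReal (Real.exp (-τ)) *
        ⨅ n : ℕ, ∏ i ∈ Finset.range n, if i = c then 1 else ENNReal.ofReal (1 + a i)⁻¹ := by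
  set Y : Ω → ℝ := fun ω => ∑' i, if i = c then 0 else a i * h i ω with hY
  have hYm : Measurable Y := measurable_tsum_ite c fun i _ => (hm i).const_mul _
  have hYpos : ∀ᵐ ω ∂μ, 0 ≤ Y ω := by
    filter_upwards [ae_gain_pos hl] with ω hω
    exact tsum_ite_nonneg (fun i => mul_nonneg (ha i) (hω i).le) c
  have hprod := (indepFun_iff_map_prod_eq_prod_map_map (hm c).aemeasurable
    hYm.aemeasurable).1 (indepFun_gain_sum hm hi a c)
  have hset : MeasurableSet {p : ℝ × ℝ | τ + p.2 < p.1} :=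
    measurableSet_lt (by fun_prop) (by fun_prop)
  -- Integrate out the gain h c, independent of Y: its tail is exponential on the nonnegative
  -- half-line.
  have h1 : μ {ω | τ + Y ω < h c ω} = ∫⁻ ω, ENNReal.ofReal (Real.exp (-(τ + Y ω))) ∂μ := by
    have e1 : μ {ω | τ + Y ω < h c ω} =
        (μ.map fun ω => (h c ω, Y ω)) {p : ℝ × ℝ | τ + p.2 < p.1} := by
      rw [Measure.map_apply ((hm c).prodMk hYm) hset]; rfl
    have := Measure.isProbabilityMeasure_map (μ := μ) (hm c).aemeasurable
    rw [e1, hprod, Measure.prod_apply_symm hset,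
      lintegral_map (measurable_measure_prodMk_right hset) hYm]
    refine lintegral_congr_ae ?_
    filter_upwards [hYpos] with ω hω
    have e2 : (fun x => (x, Y ω)) ⁻¹' {p : ℝ × ℝ | τ + p.2 < p.1} = Ioi (τ + Y ω) := rfl
    rw [e2, (hl c).map_eq, expMeasure_one_Ioi (by linarith)]
  have h2 : ∫⁻ ω, ENNReal.ofReal (Real.exp (-(τ + Y ω))) ∂μ =
      ENNReal.ofReal (Real.exp (-τ)) * ∫⁻ ω, ENNReal.ofReal (Real.exp (-Y ω)) ∂μ := by
    rw [← lintegral_const_mul' _ _ ENNReal.ofReal_ne_top]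
    refine lintegral_congr fun ω => ?_
    rw [← ENNReal.ofReal_mul (Real.exp_pos _).le, ← Real.exp_add]
    congr 2; ring
  set F : ℕ → Ω → ℝ≥0∞ := fun n ω => ∏ i ∈ Finset.range n,
    if i = c then 1 else ENNReal.ofReal (Real.exp (-(a i * h i ω))) with hF
  set X : ℕ → Ω → ℝ≥0∞ := fun i ω =>
    (fun x => if i = c then 1 else ENNReal.ofReal (Real.exp (-(a i * x)))) (h i ω) with hX
  have hgm : ∀ i, Measurable fun x : ℝ =>
      if i = c then (1 : ℝ≥0∞) else ENNReal.ofReal (Real.exp (-(a i * x))) := fun i => by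
    split_ifs <;> fun_prop
  have hXm : ∀ i, Measurable (X i) := fun i => (hgm i).comp (hm i)
  have hFint : ∀ n, ∫⁻ ω, F n ω ∂μ =
      ∏ i ∈ Finset.range n, if i = c then 1 else ENNReal.ofReal (1 + a i)⁻¹ := by
    intro n
    have := lintegral_prod_eq_prod_lintegral_of_indepFun (Finset.range n) X
      (hi.comp _ hgm) hXm
    change ∫⁻ ω, ∏ i ∈ Finset.range n, X i ω ∂μ = _
    rw [this]
    refine Finset.prod_congr rfl fun i _ => ?_
    by_cases hic : i = c
    · simp [hX, hic]
    · simp only [hX, hic, if_false]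
      rw [← lintegral_exp_neg_mul_expMeasure_one (ha i), ← (hl i).map_eq,
        lintegral_map (by fun_prop) (hm i)]
  have hFm : ∀ n, AEMeasurable (F n) μ := fun n =>
    (Finset.measurable_fun_prod _ fun i _ => hXm i).aemeasurable
  have hFanti : ∀ᵐ ω ∂μ, Antitone fun n => F n ω := by
    filter_upwards [ae_gain_pos hl] with ω hpos
    refine antitone_nat_of_succ_le fun n => ?_
    simp only [hF, Finset.prod_range_succ]
    refine mul_le_of_le_one_right' ?_
    split_ifs
    · exact le_rfl
    · rw [ENNReal.ofReal_le_one, Real.exp_le_one_iff, neg_nonpos]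
      exact mul_nonneg (ha n) (hpos n).le
  -- The partial products decrease, so their limit exp(-Y) is their infimum, and monotone
  -- convergence applies below.
  have hFinf : ∀ᵐ ω ∂μ, ENNReal.ofReal (Real.exp (-Y ω)) = ⨅ n, F n ω := by
    filter_upwards [ae_gain_pos hl, ae_summable_mul_gain hl ha hs, hFanti]
      with ω hpos hsum hanti
    have hsum' : Summable fun i => if i = c then 0 else a i * h i ω := by
      refine Summable.of_nonneg_of_le (fun i => ?_) (fun i => ?_) hsum
      · split_ifs; exacts [le_rfl, mul_nonneg (ha i) (hpos i).le]
      · split_ifs; exacts [mul_nonneg (ha i) (hpos i).le, le_rfl]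
    have hFeq : ∀ n, F n ω = ENNReal.ofReal (Real.exp
        (-∑ i ∈ Finset.range n, if i = c then 0 else a i * h i ω)) := by
      intro n
      rw [← Finset.sum_neg_distrib, Real.exp_sum,
        ENNReal.ofReal_prod_of_nonneg fun j _ => (Real.exp_pos _).le]
      refine Finset.prod_congr rfl fun i _ => ?_
      split_ifs <;> simp
    have htend : Tendsto (fun n => F n ω) atTop (𝓝 (ENNReal.ofReal (Real.exp (-Y ω)))) := by
      simp_rw [hFeq]
      exact (ENNReal.continuous_ofReal.comp (Real.continuous_exp.comp continuous_neg)).continuousAt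
        |>.tendsto.comp
        hsum'.hasSum.tendsto_sum_nat
    exact tendsto_nhds_unique htend (tendsto_atTop_iInf hanti)
  rw [h1, h2, lintegral_congr_ae hFinf, lintegral_iInf' hFm hFanti (by simp [hF])]
  simp_rw [hFint]

end fading

/-! ### The nearest station. -/

section nearest

variable {Ω : Type*} [MeasurableSpace Ω] {b : ℕ → Ω → Plane}

theorem measurable_nearest (hb : ∀ i, Measurable (b i)) (z : Plane) :
    Measurable (nearest b z) := by
  have hS : ∀ n, MeasurableSet {ω | ∀ i, dist (b n ω) z ≤ dist (b i ω) z} := fun n => by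
    simp only [ofPred_forall]
    exact MeasurableSet.iInter fun i =>
      measurableSet_le ((hb n).dist measurable_const) ((hb i).dist measurable_const)
  refine measurable_to_countable' fun k => ?_
  -- The second alternative is the default `sInf ∅ = 0`: if no index minimises the distance,
  -- `nearest` is 0.
  have : nearest b z ⁻¹' {k} =
      ({ω | ∀ i, dist (b k ω) z ≤ dist (b i ω) z} ∩
        ⋂ m : Fin k, {ω | ∀ i, dist (b m ω) z ≤ dist (b i ω) z}ᶜ) ∪
      ({_ω | k = 0} ∩ ⋂ m : ℕ, {ω | ∀ i, dist (b m ω) z ≤ dist (b i ω) z}ᶜ) := by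
    ext ω
    set S : Set ℕ := {n : ℕ | ∀ i, dist (b n ω) z ≤ dist (b i ω) z} with hSdef
    have e1 : ω ∈ nearest b z ⁻¹' {k} ↔ sInf S = k := Iff.rfl
    have e2 : (ω ∈ ({ω | ∀ i, dist (b k ω) z ≤ dist (b i ω) z} ∩
        ⋂ m : Fin k, {ω | ∀ i, dist (b m ω) z ≤ dist (b i ω) z}ᶜ) ∪
      ({_ω | k = 0} ∩ ⋂ m : ℕ, {ω | ∀ i, dist (b m ω) z ≤ dist (b i ω) z}ᶜ)) ↔
        (k ∈ S ∧ ∀ m : Fin k, (m : ℕ) ∉ S) ∨ (k = 0 ∧ ∀ m, m ∉ S) := by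
      simp only [mem_union, mem_inter_iff, mem_iInter]
      exact Iff.rfl
    rw [e1, e2]
    constructor
    · intro hk
      rcases S.eq_empty_or_nonempty with h | h
      · right
        rw [h, Nat.sInf_empty] at hk
        exact ⟨hk.symm, fun m => by rw [h]; exact notMem_empty m⟩
      · left
        rw [← hk]
        exact ⟨Nat.sInf_mem h, fun m => Nat.notMem_of_lt_sInf m.2⟩
    · rintro (⟨h1, h2⟩ | ⟨h1, h2⟩)
      · refine le_antisymm (Nat.sInf_le h1) ?_
        by_contra hlt
        exact h2 ⟨sInf S, not_le.1 hlt⟩ (Nat.sInf_mem ⟨k, h1⟩)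
      · rw [eq_empty_iff_forall_notMem.2 h2, Nat.sInf_empty, h1]
  rw [this]
  exact ((hS k).inter (MeasurableSet.iInter fun m : Fin k => (hS m).compl)).union
    ((MeasurableSet.const _).inter (MeasurableSet.iInter fun m => (hS m).compl))

theorem measurable_eval_nat {Ω β : Type*} [MeasurableSpace Ω] [MeasurableSpace β] {f : ℕ → Ω → β}
    {n : Ω → ℕ} (hf : ∀ i, Measurable (f i)) (hn : Measurable n) :
    Measurable fun ω => f (n ω) ω := by
  have h1 : Measurable fun p : ℕ × (ℕ → β) => p.2 p.1 :=
    measurable_from_prod_countable_right fun n => measurable_pi_apply n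
  exact h1.comp (hn.prodMk (measurable_pi_lambda _ hf))

theorem measurable_nearestDist (hb : ∀ i, Measurable (b i)) (z : Plane) :
    Measurable (nearestDist b z) :=
  measurable_eval_nat (f := fun i ω => dist (b i ω) z) (fun i => (hb i).dist measurable_const)
    (measurable_nearest hb z)

/-- Local finiteness makes the minimum exist: it is attained among the finitely many points no
farther away than point 0. -/
theorem nearestDist_le {Ω : Type*} {b : ℕ → Ω → Plane} {z : Plane} {ω : Ω}
    (hfin : ∀ T, {i | dist (b i ω) z ≤ T}.Finite) (i : ℕ) :
    nearestDist b z ω ≤ dist (b i ω) z := by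
  have hne : {n : ℕ | ∀ i, dist (b n ω) z ≤ dist (b i ω) z}.Nonempty := by
    obtain ⟨n, hn, hmin⟩ := Set.exists_min_image {i | dist (b i ω) z ≤ dist (b 0 ω) z}
      (fun i => dist (b i ω) z) (hfin _) ⟨0, le_refl (dist (b 0 ω) z)⟩
    refine ⟨n, fun i => ?_⟩
    rcases le_total (dist (b i ω) z) (dist (b 0 ω) z) with h | h
    · exact hmin i h
    · exact (show dist (b n ω) z ≤ dist (b 0 ω) z from hn).trans h
  exact Nat.sInf_mem hne i

end nearest

/-! ### From the plane to the half-line. -/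

theorem volume_annulus (z : Plane) {κ a a' : ℝ} (hκ : 0 < κ) (ha : 0 ≤ a) (haa' : a ≤ a') :
    volume {p : Plane | κ * dist p z ^ 2 ∈ Ioc a a'} =
      ENNReal.ofReal ((a' - a) / κ * Real.pi) := by
  have hball : ∀ s, 0 ≤ s → {p : Plane | κ * dist p z ^ 2 ≤ s} =
      Metric.closedBall z (Real.sqrt (s / κ)) := by
    intro s hs
    ext p
    change κ * dist p z ^ 2 ≤ s ↔ dist p z ≤ Real.sqrt (s / κ)
    rw [Real.le_sqrt dist_nonneg (by positivity), le_div_iff₀ hκ, mul_comm]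
  have hvol : ∀ s, 0 ≤ s → volume {p : Plane | κ * dist p z ^ 2 ≤ s} =
      ENNReal.ofReal (s / κ * Real.pi) := by
    intro s hs
    rw [hball s hs, EuclideanSpace.volume_closedBall_fin_two,
      ← ENNReal.ofReal_pow (Real.sqrt_nonneg _), Real.sq_sqrt (by positivity),
      ENNReal.ofReal_mul (by positivity)]
  have hset : {p : Plane | κ * dist p z ^ 2 ∈ Ioc a a'} =
      {p : Plane | κ * dist p z ^ 2 ≤ a'} \ {p : Plane | κ * dist p z ^ 2 ≤ a} := by
    ext p
    change (a < κ * dist p z ^ 2 ∧ κ * dist p z ^ 2 ≤ a') ↔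
      (κ * dist p z ^ 2 ≤ a' ∧ ¬ κ * dist p z ^ 2 ≤ a)
    rw [not_le, and_comm]
  have hm : MeasurableSet {p : Plane | κ * dist p z ^ 2 ≤ a} :=
    measurableSet_le (by fun_prop) measurable_const
  have hsub : {p : Plane | κ * dist p z ^ 2 ≤ a} ⊆ {p : Plane | κ * dist p z ^ 2 ≤ a'} :=
    fun p hp => le_trans (show κ * dist p z ^ 2 ≤ a from hp) haa'
  rw [hset, measure_sdiff hsub hm.nullMeasurableSet, hvol a ha,
    hvol a' (ha.trans haa'), ← ENNReal.ofReal_sub _ (by positivity)]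
  · congr 1; ring
  · rw [hvol a ha]; exact ENNReal.ofReal_ne_top

/-- The areas of the disks around `z` reaching up to the points of a planar Poisson process form,
after scaling by the intensity, a Poisson process of rate one. -/
theorem IsPoissonProcess.isUnitRatePoisson {Ω : Type*} [MeasurableSpace Ω] {μ : Measure Ω}
    {b : ℕ → Ω → Plane} {lam : ℝ} (hb : IsPoissonProcess b lam μ) (hlam : 0 < lam) (z : Plane) :
    IsUnitRatePoisson (fun i ω => Real.pi * lam * dist (b i ω) z ^ 2) μ := by
  have hκ : 0 < Real.pi * lam := by positivity
  have hmeas : ∀ a a', MeasurableSet {p : Plane | Real.pi * lam * dist p z ^ 2 ∈ Ioc a a'} :=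
    fun a a' => (show Measurable fun p : Plane => Real.pi * lam * dist p z ^ 2 by fun_prop)
      measurableSet_Ioc
  refine ⟨fun i => ?_, ?_, fun a a' ha haa' => ?_, fun t ht ht0 n => ?_⟩
  · exact (((hb.measurable i).dist measurable_const).pow_const 2).const_mul _
  · have h0 := hb.hasLaw_count {z} (measurableSet_singleton z) (by simp)
    have h1 : ∀ᵐ ω ∂μ, count b {z} ω = 0 := by
      refine (h0.ae_iff (p := fun k => k = 0) .of_discrete).2 ?_
      rw [ae_map_iff .of_discrete .of_discrete]
      have h2 : poissonMeasure 0 {0} = 1 := by rw [poissonMeasure_singleton]; simp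
      have h3 := (prob_compl_eq_zero_iff (measurableSet_singleton (0 : ℕ))).2 h2
      simp only [measure_singleton, ENNReal.toNNReal_zero, mul_zero]
      filter_upwards [compl_mem_ae_iff.2 h3] with k hk
      have : k = 0 := by simpa using hk
      simp [this]
    filter_upwards [h1] with ω hω i
    rw [count, Set.encard_eq_zero, eq_empty_iff_forall_notMem] at hω
    have : 0 < dist (b i ω) z := dist_pos.2 fun h => hω i h
    positivity
  · have hv := volume_annulus z hκ ha haa'
    have h1 := hb.hasLaw_count _ (hmeas a a') (by rw [hv]; exact ENNReal.ofReal_ne_top)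
    have h2 : lam.toNNReal *
        (volume {p : Plane | Real.pi * lam * dist p z ^ 2 ∈ Ioc a a'}).toNNReal =
        (a' - a).toNNReal := by
      rw [hv, ENNReal.ofReal, ENNReal.toNNReal_coe, ← Real.toNNReal_mul hlam.le]
      congr 1
      field_simp
    rw [h2] at h1
    exact h1
  · refine hb.indep_count n
      (fun j => {p : Plane | Real.pi * lam * dist p z ^ 2 ∈ Ioc (t j) (t (j + 1))})
      (fun j => hmeas _ _) fun i j hij => ?_
    refine Set.disjoint_left.2 fun p hp hp' => ?_
    have hp1 : Real.pi * lam * dist p z ^ 2 ∈ Ioc (t i) (t (i + 1)) := hp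
    have hp2 : Real.pi * lam * dist p z ^ 2 ∈ Ioc (t j) (t (j + 1)) := hp'
    rcases lt_or_gt_of_ne hij with h | h
    · exact absurd (hp1.2.trans (ht (Nat.succ_le_of_lt h))) (not_le.2 hp2.1)
    · exact absurd (hp2.2.trans (ht (Nat.succ_le_of_lt h))) (not_le.2 hp1.1)

theorem lintegral_Ioi_comp_mul_sq {κ : ℝ} (hκ : 0 < κ) (g : ℝ → ℝ≥0∞) :
    ∫⁻ x in Ioi 0, g x = ∫⁻ r in Ioi (0 : ℝ), ENNReal.ofReal (2 * κ * r) * g (κ * r ^ 2) := by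
  have himg : (fun r : ℝ => κ * r ^ 2) '' Ioi 0 = Ioi 0 := by
    ext x
    constructor
    · rintro ⟨r, hr, rfl⟩
      have : 0 < r := hr
      exact mem_Ioi.2 (by positivity)
    · intro hx
      have hx' : 0 < x := hx
      refine ⟨Real.sqrt (x / κ), Real.sqrt_pos.2 (by positivity), ?_⟩
      simp only
      rw [Real.sq_sqrt (by positivity)]
      field_simp
  have hinj : InjOn (fun r : ℝ => κ * r ^ 2) (Ioi 0) := by
    intro r hr s hs hrs
    have h1 : r ^ 2 = s ^ 2 := mul_left_cancel₀ hκ.ne' hrs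
    exact (pow_left_inj₀ (le_of_lt hr) (le_of_lt hs) two_ne_zero).1 h1
  have h := lintegral_image_eq_lintegral_abs_deriv_mul (f := fun r : ℝ => κ * r ^ 2)
    (f' := fun r => 2 * κ * r) (s := Ioi 0) measurableSet_Ioi
    (fun r _ => by
      have := ((hasDerivAt_pow 2 r).const_mul κ).hasDerivWithinAt (s := Ioi 0)
      convert! this using 1
      simp; ring) hinj g
  rw [himg] at h
  rw [h]
  refine setLIntegral_congr_fun measurableSet_Ioi fun r hr => ?_
  have : 0 < r := hr
  rw [abs_of_pos (by positivity)]

/-! ### Joint law of the nearest distance and a threshold event for its gain. -/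

/-- Interference relative to the power received from the nearest station, without its gain. -/
noncomputable def relInterference {Ω : Type*} (b : ℕ → Ω → Plane) (h : ℕ → Ω → ℝ) (α : ℝ)
    (z : Plane) (ω : Ω) : ℝ :=
  ∑' i : ℕ, if i = nearest b z ω then 0 else
    nearestDist b z ω ^ α * dist (b i ω) z ^ (-α) * h i ω

section

variable {Ω : Type*} [MeasurableSpace Ω] {b : ℕ → Ω → Plane} {h : ℕ → Ω → ℝ}

theorem measurable_relInterference (hb : ∀ i, Measurable (b i)) (hh : ∀ i, Measurable (h i))
    (α : ℝ) (z : Plane) : Measurable (relInterference b h α z) := by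
  refine Measurable.tsum fun i => Measurable.ite ?_ measurable_const ?_
  · have := measurable_nearest hb z (measurableSet_singleton i)
    convert this using 1
    ext ω; exact eq_comm
  · exact (((measurable_nearestDist hb z).pow_const α).mul
      (((hb i).dist measurable_const).pow_const _)).mul (hh i)

theorem measurable_nearestGain (hb : ∀ i, Measurable (b i)) (hh : ∀ i, Measurable (h i))
    (z : Plane) : Measurable (nearestGain b h z) :=
  measurable_eval_nat hh (measurable_nearest hb z)

variable {μ : Measure Ω} {lam α : ℝ}

/-- Almost sure properties of the distances in a Poisson process. -/
theorem IsPoissonProcess.ae_regular (hb : IsPoissonProcess b lam μ) (hlam : 0 < lam)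
    (hα : 2 < α) (z : Plane) :
    ∀ᵐ ω ∂μ, (∀ i, 0 < dist (b i ω) z) ∧ (∀ i, nearestDist b z ω ≤ dist (b i ω) z) ∧
      Summable fun i => dist (b i ω) z ^ (-α) := by
  have hκ : 0 < Real.pi * lam := by positivity
  have hu := hb.isUnitRatePoisson hlam z
  filter_upwards [hu.pos, hu.ae_finite, hu.ae_summable_rpow_neg (ρ := α / 2) (by linarith)]
    with ω hpos hfin hsum
  have hpos' : ∀ i, 0 < dist (b i ω) z := fun i => by
    refine lt_of_le_of_ne dist_nonneg fun h0 => ?_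
    have := hpos i
    rw [← h0] at this
    simp at this
  refine ⟨hpos', nearestDist_le fun T => ?_, ?_⟩
  · refine (hfin (Real.pi * lam * T ^ 2)).subset fun i hi => ?_
    have hi' : dist (b i ω) z ≤ T := hi
    change Real.pi * lam * dist (b i ω) z ^ 2 ≤ Real.pi * lam * T ^ 2
    have := hpos' i
    gcongr
  · refine (hsum.mul_left ((Real.pi * lam) ^ (α / 2))).congr fun i => ?_
    rw [Real.mul_rpow hκ.le (by positivity), ← mul_assoc, ← Real.rpow_add hκ,
      add_neg_cancel, Real.rpow_zero, one_mul, ← Real.rpow_natCast_mul (hpos' i).le]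
    congr 1
    push_cast; ring

/-- Area coordinates are squares of distances, so the path loss exponent α appears as ρ = α / 2. -/
theorem attenuation_sq_ratio {β κ R r : ℝ} (hκ : 0 < κ) (hR : 0 < R) (hr : 0 < r) (α : ℝ) :
    attenuation β (α / 2) (κ * R ^ 2 / (κ * r ^ 2)) = (1 + β * (R ^ α * r ^ (-α)))⁻¹ := by
  have h1 : κ * R ^ 2 / (κ * r ^ 2) = (R / r) ^ 2 := by field_simp
  rw [attenuation, h1, ← Real.rpow_natCast_mul (by positivity), Real.div_rpow hR.le hr.le,
    Real.rpow_neg hr.le, ← div_eq_mul_inv]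
  have h2 : ((2 : ℕ) : ℝ) * (α / 2) = α := by push_cast; ring
  rw [h2]

/-- Joint law of the distance to the nearest station and of the event that its gain exceeds a
threshold depending on the distance and the interference. -/
theorem measure_nearestDist_inter_lt_gain [IsProbabilityMeasure μ] (hlam : 0 < lam) (hα : 2 < α)
    (hb : IsPoissonProcess b lam μ) (hh : IsRayleighFading h b μ) (z : Plane) {β : ℝ}
    (hβ : 0 ≤ β) {τ : ℝ → ℝ} (hτm : Measurable τ) (hτ : ∀ r, 0 < r → 0 ≤ τ r) {A : Set ℝ}
    (hA : MeasurableSet A) :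
    μ {ω | nearestDist b z ω ∈ A ∧ τ (nearestDist b z ω) + β * relInterference b h α z ω <
        nearestGain b h z ω} =
      ∫⁻ r in A ∩ Ioi 0, ENNReal.ofReal (2 * Real.pi * lam * r * Real.exp (-τ r) *
        Real.exp (-(Real.pi * lam * r ^ 2 * (1 + decayRate β (α / 2))))) := by
  set κ := Real.pi * lam with hκdef
  have hκ : 0 < κ := by positivity
  -- The event is moved to the space of pairs (locations, gains), by evaluating the same definitions
  -- on the coordinate maps. There independence is a product measure, and Fubini allows the
  -- locations to be frozen.
  set ptm : ℕ → (ℕ → Plane) × (ℕ → ℝ) → Plane := fun i x => x.1 i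
  set gn : ℕ → (ℕ → Plane) × (ℕ → ℝ) → ℝ := fun i x => x.2 i
  have hptm : ∀ i, Measurable (ptm i) := fun i => by fun_prop
  have hgn : ∀ i, Measurable (gn i) := fun i => by fun_prop
  set E : Set ((ℕ → Plane) × (ℕ → ℝ)) := {x | nearestDist ptm z x ∈ A ∧
    τ (nearestDist ptm z x) + β * relInterference ptm gn α z x < nearestGain ptm gn z x} with hE
  have hEm : MeasurableSet E := by
    have h2 : MeasurableSet {x | τ (nearestDist ptm z x) + β * relInterference ptm gn α z x <
        nearestGain ptm gn z x} := measurableSet_lt ?_ ?_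
    · exact (measurable_nearestDist hptm z hA).inter h2
    · exact (hτm.comp (measurable_nearestDist hptm z)).add
        ((measurable_relInterference hptm hgn α z).const_mul β)
    · exact measurable_nearestGain hptm hgn z
  have hBm : Measurable fun ω i => b i ω := measurable_pi_lambda _ hb.measurable
  have hHm : Measurable fun ω i => h i ω := measurable_pi_lambda _ hh.measurable
  have hprod := (indepFun_iff_map_prod_eq_prod_map_map hBm.aemeasurable hHm.aemeasurable).1
    hh.indep_points
  have := Measure.isProbabilityMeasure_map (μ := μ) hHm.aemeasurable
  have h1 : μ {ω | nearestDist b z ω ∈ A ∧ τ (nearestDist b z ω) +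
      β * relInterference b h α z ω < nearestGain b h z ω} =
      (μ.map fun ω => ((fun i => b i ω), fun i => h i ω)) E := by
    rw [Measure.map_apply (hBm.prodMk hHm) hEm]; rfl
  have hu := hb.isUnitRatePoisson hlam z
  set f : ℝ → ℝ≥0∞ := fun x => A.indicator 1 (Real.sqrt (x / κ)) *
    ENNReal.ofReal (Real.exp (-τ (Real.sqrt (x / κ)))) with hf
  have hfm : Measurable f := by
    have hs : Measurable fun x => Real.sqrt (x / κ) := by fun_prop
    exact ((measurable_one.indicator hA).comp hs).mul
      (Real.measurable_exp.comp (hτm.comp hs).neg).ennreal_ofReal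
  have hsqrt : ∀ r, 0 < r → Real.sqrt (κ * r ^ 2 / κ) = r := fun r hr => by
    rw [mul_div_cancel_left₀ _ hκ.ne', Real.sqrt_sq hr.le]
  have hc : ∀ᵐ ω ∂μ, ∀ i, κ * dist (b (nearest b z ω) ω) z ^ 2 ≤ κ * dist (b i ω) z ^ 2 := by
    filter_upwards [hb.ae_regular hlam hα z] with ω hω i
    have := hω.2.1 i
    rw [nearestDist] at this
    gcongr
  rw [h1, hprod, Measure.prod_apply hEm, lintegral_map (measurable_measure_prodMk_left hEm) hBm]
  -- For frozen locations the slice has the probability computed by `measure_tsum_lt_gain`, with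
  -- weights β R^α r_i^{-α}, R being the nearest distance.
  have h2 : ∀ᵐ ω ∂μ, (μ.map fun ω i => h i ω) (Prod.mk (fun i => b i ω) ⁻¹' E) =
      f (κ * dist (b (nearest b z ω) ω) z ^ 2) *
        otherAttenuation β (α / 2) (fun i => κ * dist (b i ω) z ^ 2) (nearest b z ω) := by
    filter_upwards [hb.ae_regular hlam hα z] with ω hω
    obtain ⟨hpos, hmin, hsum⟩ := hω
    have hR : 0 < nearestDist b z ω := hpos _
    rw [Measure.map_apply hHm (measurable_prodMk_left hEm)]
    have hfR : f (κ * dist (b (nearest b z ω) ω) z ^ 2) = A.indicator 1 (nearestDist b z ω) *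
        ENNReal.ofReal (Real.exp (-τ (nearestDist b z ω))) := by
      simp only [hf, hsqrt _ (hpos _)]; rfl
    rw [hfR]
    have hslice : (fun ω i => h i ω) ⁻¹' (Prod.mk (fun i => b i ω) ⁻¹' E) =
        {ω' | nearestDist b z ω ∈ A ∧ τ (nearestDist b z ω) +
          β * (∑' i : ℕ, if i = nearest b z ω then 0 else
            nearestDist b z ω ^ α * dist (b i ω) z ^ (-α) * h i ω') < h (nearest b z ω) ω'} := rfl
    rw [hslice]
    by_cases hRA : nearestDist b z ω ∈ A
    · simp only [hRA, true_and, indicator_of_mem, Pi.one_apply, one_mul]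
      have key := measure_tsum_lt_gain hh.measurable hh.hasLaw hh.indep
        (a := fun i => β * (nearestDist b z ω ^ α * dist (b i ω) z ^ (-α)))
        (fun i => by have := hpos i; positivity) ((hsum.mul_left _).mul_left _) (nearest b z ω)
        (hτ _ hR)
      have hprod : otherAttenuation β (α / 2) (fun i => κ * dist (b i ω) z ^ 2) (nearest b z ω) =
          ⨅ n : ℕ, ∏ i ∈ Finset.range n, if i = nearest b z ω then 1 else ENNReal.ofReal
            (1 + β * (nearestDist b z ω ^ α * dist (b i ω) z ^ (-α)))⁻¹ := by
        unfold otherAttenuation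
        refine iInf_congr fun n => Finset.prod_congr rfl fun i _ => ?_
        rw [attenuation_sq_ratio hκ (hpos _) (hpos i)]; rfl
      rw [hprod, ← key]
      congr 1
      ext ω'
      have : β * (∑' i : ℕ, if i = nearest b z ω then 0 else
            nearestDist b z ω ^ α * dist (b i ω) z ^ (-α) * h i ω') =
          ∑' i : ℕ, if i = nearest b z ω then 0 else
            β * (nearestDist b z ω ^ α * dist (b i ω) z ^ (-α)) * h i ω' := by
        rw [← tsum_mul_left]
        refine tsum_congr fun i => ?_
        split_ifs
        · rw [mul_zero]
        · ring
      simp only [mem_ofPred_eq, this]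
    · simp [hRA]
  rw [lintegral_congr_ae h2,
    hu.lintegral_nearest_mul_otherAttenuation (measurable_nearest hb.measurable z) hc hβ
      (by linarith) hfm, lintegral_Ioi_comp_mul_sq hκ, ← setLIntegral_indicator hA]
  refine setLIntegral_congr_fun measurableSet_Ioi fun r hr => ?_
  have hr' : 0 < r := hr
  simp only [hf, hsqrt r hr']
  by_cases hrA : r ∈ A
  · rw [indicator_of_mem hrA, indicator_of_mem hrA, Pi.one_apply, one_mul,
      ← ENNReal.ofReal_mul (Real.exp_pos _).le, ← ENNReal.ofReal_mul (by positivity), hκdef]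
    ring_nf
  · simp [indicator_of_notMem hrA]

end

/-! ### The decay rate through L, and convergence of the double integral. -/

theorem decayRate_zero (ρ : ℝ) : decayRate 0 ρ = 0 := by simp [decayRate, attenuation]

/-- The substitution w = β^{2/α} u², which sends u = β^{-1/α} to w = 1. -/
theorem decayRate_eq_L {β α : ℝ} (hβ : 0 < β) (hα : 0 < α) :
    decayRate β (α / 2) = 2 * β ^ (2 / α) * L β α := by
  have hB : 0 < β ^ (2 / α) := Real.rpow_pos_of_pos hβ _
  have hs0 : 0 < β ^ (-(1 / α)) := Real.rpow_pos_of_pos hβ _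
  have hsq : β ^ (2 / α) * (β ^ (-(1 / α))) ^ 2 = 1 := by
    rw [← Real.rpow_mul_natCast hβ.le, ← Real.rpow_add hβ]
    have : 2 / α + -(1 / α) * ((2 : ℕ) : ℝ) = 0 := by push_cast; ring
    rw [this, Real.rpow_zero]
  have himg : (fun u : ℝ => β ^ (2 / α) * u ^ 2) '' Ioi (β ^ (-(1 / α))) = Ioi 1 := by
    ext w
    constructor
    · rintro ⟨u, hu, rfl⟩
      rw [mem_Ioi, ← hsq]
      have : β ^ (-(1 / α)) < u := hu
      change _ < β ^ (2 / α) * u ^ 2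
      gcongr
    · intro hw
      have hw1 : 1 < w := hw
      refine ⟨Real.sqrt (w / β ^ (2 / α)), ?_, ?_⟩
      · rw [mem_Ioi, Real.lt_sqrt hs0.le, lt_div_iff₀ hB, mul_comm, hsq]
        exact hw1
      · simp only
        rw [Real.sq_sqrt (by positivity)]
        field_simp
  have hinj : InjOn (fun u : ℝ => β ^ (2 / α) * u ^ 2) (Ioi (β ^ (-(1 / α)))) := by
    intro r hr s hs hrs
    have h1 : r ^ 2 = s ^ 2 := mul_left_cancel₀ hB.ne' hrs
    exact (pow_left_inj₀ (hs0.trans hr).le (hs0.trans hs).le two_ne_zero).1 h1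
  have h := integral_image_eq_integral_abs_deriv_smul (f := fun u : ℝ => β ^ (2 / α) * u ^ 2)
    (f' := fun u => 2 * β ^ (2 / α) * u) (s := Ioi (β ^ (-(1 / α)))) measurableSet_Ioi
    (fun r _ => by
      have := ((hasDerivAt_pow 2 r).const_mul (β ^ (2 / α))).hasDerivWithinAt
        (s := Ioi (β ^ (-(1 / α))))
      convert! this using 1
      simp; ring) hinj (fun w => 1 - attenuation β (α / 2) w⁻¹)
  rw [himg] at h
  rw [decayRate, h, L, ← integral_const_mul]
  refine setIntegral_congr_fun measurableSet_Ioi fun u hu => ?_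
  have hu0 : 0 < u := hs0.trans hu
  have hpow : (β ^ (2 / α) * u ^ 2) ^ (α / 2) = β * u ^ α := by
    rw [Real.mul_rpow hB.le (by positivity), ← Real.rpow_mul hβ.le,
      ← Real.rpow_natCast_mul hu0.le]
    have e1 : 2 / α * (α / 2) = 1 := by field_simp
    have e2 : ((2 : ℕ) : ℝ) * (α / 2) = α := by push_cast; ring
    rw [e1, e2, Real.rpow_one]
  have hua : 0 < u ^ α := Real.rpow_pos_of_pos hu0 _
  simp only [smul_eq_mul]
  rw [abs_of_pos (by positivity), attenuation, Real.inv_rpow (by positivity), hpow]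
  field_simp
  ring

/-- Up to w = β^{1/ρ} the integrand of the decay rate is at least 1/2. For β = e^t - 1 this makes 1
+ C grow exponentially in t, which gives integrability in t. -/
theorem rpow_le_two_mul_one_add_decayRate {β ρ : ℝ} (hβ : 0 < β) (hρ : 1 < ρ) :
    (1 + β) ^ (1 / ρ) ≤ 2 * (1 + decayRate β ρ) := by
  have hC := decayRate_nonneg (ρ := ρ) hβ.le
  have hρ0 : 0 < ρ := by linarith
  have h1 : (1 + β) ^ (1 / ρ) ≤ 1 + β ^ (1 / ρ) := by
    have := Real.rpow_add_le_add_rpow zero_le_one hβ.le (p := 1 / ρ) (by positivity)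
      (by rw [div_le_one hρ0]; exact hρ.le)
    rwa [Real.one_rpow] at this
  rcases le_or_gt β 1 with hβ1 | hβ1
  · have : β ^ (1 / ρ) ≤ 1 := Real.rpow_le_one hβ.le hβ1 (by positivity)
    linarith
  set B := β ^ (1 / ρ) with hB
  have hB1 : 1 ≤ B := Real.one_le_rpow hβ1.le (by positivity)
  have h2 : ∫ w in Ioc 1 B, (1 / 2 : ℝ) ≤ decayRate β ρ := by
    have hint := integrableOn_one_sub_attenuation_inv hβ.le hρ
    calc ∫ w in Ioc 1 B, (1 / 2 : ℝ) ≤ ∫ w in Ioc 1 B, (1 - attenuation β ρ w⁻¹) := by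
          refine setIntegral_mono_on (by simp) (hint.mono_set Ioc_subset_Ioi_self)
            measurableSet_Ioc fun w hw => ?_
          have hw0 : 0 < w := one_pos.trans hw.1
          have hwr : 0 < w ^ ρ := Real.rpow_pos_of_pos hw0 _
          have hle : w ^ ρ ≤ β := by
            have := Real.rpow_le_rpow hw0.le hw.2 hρ0.le
            rwa [hB, ← Real.rpow_mul hβ.le, one_div_mul_cancel hρ0.ne', Real.rpow_one] at this
          have h3 : 1 ≤ β * w⁻¹ ^ ρ := by
            rw [Real.inv_rpow hw0.le, ← div_eq_mul_inv, one_le_div hwr]; exact hle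
          have h4 : attenuation β ρ w⁻¹ ≤ 2⁻¹ := inv_anti₀ (by norm_num) (by linarith)
          linarith
      _ ≤ decayRate β ρ := by
          refine setIntegral_mono_set hint ?_ (LE.le.eventuallyLE Ioc_subset_Ioi_self)
          filter_upwards [self_mem_ae_restrict measurableSet_Ioi] with w hw
          have := attenuation_le_one (ρ := ρ) hβ.le (inv_nonneg.2 (one_pos.trans hw).le)
          simp only [Pi.zero_apply]
          linarith
  rw [setIntegral_const, measureReal_def, Real.volume_Ioc, ENNReal.toReal_ofReal (by linarith),
    smul_eq_mul] at h2
  linarith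

theorem measurable_decayRate (ρ : ℝ) : Measurable fun β => decayRate β ρ := by
  have : StronglyMeasurable fun p : ℝ × ℝ => 1 - attenuation p.1 ρ p.2⁻¹ := by
    refine Measurable.stronglyMeasurable ?_
    unfold attenuation
    fun_prop
  exact (this.integral_prod_right (ν := volume.restrict (Ioi 1))).measurable

theorem lintegral_Ioi_mul_exp_neg_sq {a : ℝ} (ha : 0 < a) :
    ∫⁻ r in Ioi (0 : ℝ), ENNReal.ofReal (2 * a * r * Real.exp (-(a * r ^ 2))) = 1 := by
  have h := lintegral_Ioi_comp_mul_sq ha fun x => ENNReal.ofReal (Real.exp (-x))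
  rw [← ofReal_integral_eq_lintegral_ofReal (integrableOn_exp_neg_Ioi 0)
        (Eventually.of_forall fun _ => (Real.exp_pos _).le), integral_exp_neg_Ioi_zero,
        ENNReal.ofReal_one] at h
  rw [h]
  refine setLIntegral_congr_fun measurableSet_Ioi fun r hr => ?_
  have hr' : 0 < r := hr
  exact ENNReal.ofReal_mul (by positivity)

/-- Probability that the ratio exceeds `exp t - 1` at distance `r` from the nearest station. -/
noncomputable def coverage (lam P α σ r t : ℝ) : ℝ :=
  Real.exp (-((Real.exp t - 1) / P * r ^ α * σ ^ 2)) *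
    Real.exp (-(Real.pi * lam * r ^ 2 * decayRate (Real.exp t - 1) (α / 2)))

theorem coverage_eq {lam P α σ r t : ℝ} (hα : 0 < α) (hr : 0 < r) (ht : 0 < t) :
    coverage lam P α σ r t = Real.exp (-((Real.exp t - 1) / P * r ^ α * σ ^ 2)) *
      Real.exp (-(2 * Real.pi * lam * ((Real.exp t - 1) / r ^ (-α)) ^ (2 / α) *
        L (Real.exp t - 1) α)) := by
  have hβ : 0 < Real.exp t - 1 := by linarith [Real.add_one_lt_exp ht.ne']
  have h1 : ((Real.exp t - 1) / r ^ (-α)) ^ (2 / α) = (Real.exp t - 1) ^ (2 / α) * r ^ 2 := by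
    rw [Real.rpow_neg hr.le, div_inv_eq_mul, Real.mul_rpow hβ.le (by positivity),
      ← Real.rpow_mul hr.le, mul_div_cancel₀ _ hα.ne', Real.rpow_two]
  rw [coverage, decayRate_eq_L hβ hα, h1]
  congr 2; ring

theorem coverage_pos (lam P α σ r t : ℝ) : 0 < coverage lam P α σ r t := by
  unfold coverage; positivity

theorem measurable_coverage (lam P α σ : ℝ) :
    Measurable fun p : ℝ × ℝ => coverage lam P α σ p.1 p.2 := by
  have h1 : Measurable fun p : ℝ × ℝ => decayRate (Real.exp p.2 - 1) (α / 2) :=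
    (measurable_decayRate (α / 2)).comp (by fun_prop)
  unfold coverage
  fun_prop

/-- Drop the noise and the weight w and integrate over r first: the result 1 / (2κ(1 + C)), with κ =
π λ, is at most κ⁻¹ e^{-2t/α}. -/
theorem lintegral_coverage_lt_top {lam P α σ : ℝ} (hlam : 0 < lam) (hP : 0 < P) (hα : 2 < α)
    {w : ℝ → ℝ} (hw : Measurable w) (hw0 : ∀ r, 0 < r → 0 ≤ w r) :
    ∫⁻ p in Ioi (0 : ℝ) ×ˢ Ioi (0 : ℝ), ENNReal.ofReal
      (p.1 * Real.exp (-(Real.pi * lam * p.1 ^ 2) - w p.1) * coverage lam P α σ p.1 p.2) < ⊤ := by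
  set κ := Real.pi * lam with hκdef
  have hκ : 0 < κ := by positivity
  have hm : Measurable fun p : ℝ × ℝ => ENNReal.ofReal
      (p.1 * Real.exp (-(κ * p.1 ^ 2) - w p.1) * coverage lam P α σ p.1 p.2) := by
    have := measurable_coverage lam P α σ
    fun_prop
  rw [Measure.volume_eq_prod, ← Measure.prod_restrict, lintegral_prod_symm _ hm.aemeasurable]
  have hbound : ∀ t ∈ Ioi (0 : ℝ), ∫⁻ r in Ioi (0 : ℝ), ENNReal.ofReal
      (r * Real.exp (-(κ * r ^ 2) - w r) * coverage lam P α σ r t) ≤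
      ENNReal.ofReal (κ⁻¹ * Real.exp (-(2 / α) * t)) := by
    intro t ht
    have ht' : 0 < t := ht
    have hβ : 0 < Real.exp t - 1 := by linarith [Real.add_one_lt_exp ht'.ne']
    set C := decayRate (Real.exp t - 1) (α / 2) with hC
    have hC0 : 0 ≤ C := decayRate_nonneg hβ.le
    have ha : 0 < κ * (1 + C) := by positivity
    calc _ ≤ ∫⁻ r in Ioi (0 : ℝ), ENNReal.ofReal (2 * (κ * (1 + C)))⁻¹ *
          ENNReal.ofReal (2 * (κ * (1 + C)) * r * Real.exp (-(κ * (1 + C) * r ^ 2))) := by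
          refine setLIntegral_mono' measurableSet_Ioi fun r hr => ?_
          have hr' : 0 < r := hr
          rw [← ENNReal.ofReal_mul (by positivity)]
          refine ENNReal.ofReal_le_ofReal ?_
          have e1 : (2 * (κ * (1 + C)))⁻¹ * (2 * (κ * (1 + C)) * r *
              Real.exp (-(κ * (1 + C) * r ^ 2))) = r * Real.exp (-(κ * (1 + C) * r ^ 2)) := by
            field_simp
          rw [e1, coverage, mul_assoc]
          refine mul_le_mul_of_nonneg_left ?_ hr'.le
          rw [← Real.exp_add, ← Real.exp_add, Real.exp_le_exp]
          have h1 := hw0 r hr'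
          have h2 : 0 ≤ (Real.exp t - 1) / P * r ^ α * σ ^ 2 := by
            have := Real.rpow_pos_of_pos hr' α
            positivity
          rw [← hκdef, ← hC]
          linarith
      _ = ENNReal.ofReal (2 * (κ * (1 + C)))⁻¹ := by
          rw [lintegral_const_mul' _ _ ENNReal.ofReal_ne_top, lintegral_Ioi_mul_exp_neg_sq ha,
            mul_one]
      _ ≤ _ := by
          refine ENNReal.ofReal_le_ofReal ?_
          have h1 := rpow_le_two_mul_one_add_decayRate hβ (ρ := α / 2) (by linarith)
          rw [← hC, add_sub_cancel, ← Real.exp_mul] at h1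
          have h2 : -(2 / α) * t = -(t * (1 / (α / 2))) := by field_simp
          rw [h2, Real.exp_neg, ← mul_inv]
          refine inv_anti₀ (by positivity) ?_
          calc κ * Real.exp (t * (1 / (α / 2))) ≤ κ * (2 * (1 + C)) := by gcongr
            _ = _ := by ring
  refine (setLIntegral_mono' measurableSet_Ioi hbound).trans_lt ?_
  have hα' : -(2 / α) < 0 := by
    have : 0 < 2 / α := by positivity
    linarith
  exact IntegrableOn.setLIntegral_lt_top ((integrableOn_exp_mul_Ioi hα' 0).const_mul κ⁻¹)

/-! ### The ratio and its conditional law given the nearest distance. -/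

section

variable {Ω : Type*} [MeasurableSpace Ω] {b : ℕ → Ω → Plane} {h : ℕ → Ω → ℝ} {z : Plane}
  {μ : Measure Ω} [IsProbabilityMeasure μ] {lam P α σ k γ : ℝ}

theorem ae_summable_received (hlam : 0 < lam) (hα : 2 < α)
    (hb : IsPoissonProcess b lam μ) (hh : IsRayleighFading h b μ) (z : Plane) :
    ∀ᵐ ω ∂μ, Summable fun i => dist (b i ω) z ^ (-α) * h i ω := by
  -- Failure of summability is encoded as an infinite sum in `ℝ≥0∞`, which is a measurable event, so
  -- Fubini applies.
  set N : Set ((ℕ → Plane) × (ℕ → ℝ)) :=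
    (fun x => ∑' i, ENNReal.ofReal (dist (x.1 i) z ^ (-α) * x.2 i)) ⁻¹' {⊤} with hN
  have hNm : MeasurableSet N := by
    refine (Measurable.tsum fun i => ?_) (measurableSet_singleton _)
    have : Measurable fun x : (ℕ → Plane) × (ℕ → ℝ) => dist (x.1 i) z := by fun_prop
    fun_prop
  have hBm : Measurable fun ω i => b i ω := measurable_pi_lambda _ hb.measurable
  have hHm : Measurable fun ω i => h i ω := measurable_pi_lambda _ hh.measurable
  have hprod := (indepFun_iff_map_prod_eq_prod_map_map hBm.aemeasurable hHm.aemeasurable).1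
    hh.indep_points
  have := Measure.isProbabilityMeasure_map (μ := μ) hHm.aemeasurable
  have h0 : μ ((fun ω => ((fun i => b i ω), fun i => h i ω)) ⁻¹' N) = 0 := by
    rw [← Measure.map_apply (hBm.prodMk hHm) hNm, hprod, Measure.prod_apply hNm,
      lintegral_map (measurable_measure_prodMk_left hNm) hBm]
    refine (lintegral_congr_ae ?_).trans lintegral_zero
    filter_upwards [hb.ae_regular hlam hα z] with ω hω
    rw [Measure.map_apply hHm (measurable_prodMk_left hNm)]
    refine measure_mono_null ?_ (ae_iff.1 (ae_summable_mul_gain hh.hasLaw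
      (fun i => Real.rpow_nonneg dist_nonneg _) hω.2.2))
    intro ω' hω' hsum
    exact hsum.tsum_ofReal_ne_top hω'
  filter_upwards [compl_mem_ae_iff.2 h0, ae_gain_pos hh.hasLaw] with ω hω hpos
  have h1 : ∑' i, ENNReal.ofReal (dist (b i ω) z ^ (-α) * h i ω) ≠ ⊤ := hω
  refine (ENNReal.summable_toReal h1).congr fun i => ?_
  rw [ENNReal.toReal_ofReal (mul_nonneg (Real.rpow_nonneg dist_nonneg _) (hpos i).le)]

theorem measurable_sinr (hb : ∀ i, Measurable (b i)) (hh : ∀ i, Measurable (h i)) (P α σ : ℝ)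
    (z : Plane) : Measurable (sinr b h P α σ z) := by
  have h1 : Measurable (interference b h P α z) := by
    refine Measurable.tsum fun i => Measurable.ite ?_ measurable_const ?_
    · have := measurable_nearest hb z (measurableSet_singleton i)
      convert this using 1
      ext ω; exact eq_comm
    · exact ((hh i).const_mul P).mul (((hb i).dist measurable_const).pow_const _)
  exact (((measurable_nearestGain hb hh z).const_mul P).mul
    ((measurable_nearestDist hb z).pow_const _)).div (h1.add_const _)

/-- Almost surely the ratio is nonnegative and its tail events are threshold events for the gain of
the nearest station. -/
theorem ae_sinr_regular (hlam : 0 < lam) (hP : 0 < P) (hα : 2 < α)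
    (hb : IsPoissonProcess b lam μ) (hh : IsRayleighFading h b μ) (σ : ℝ) (z : Plane) :
    ∀ᵐ ω ∂μ, 0 < nearestDist b z ω ∧ 0 < nearestGain b h z ω ∧ 0 ≤ sinr b h P α σ z ω ∧
      ∀ β, β < sinr b h P α σ z ω ↔ β / P * nearestDist b z ω ^ α * σ ^ 2 +
        β * relInterference b h α z ω < nearestGain b h z ω := by
  filter_upwards [hb.ae_regular hlam hα z, ae_gain_pos hh.hasLaw,
    ae_summable_received hlam hα hb hh z] with ω hω hpos hsum
  obtain ⟨hd, -, -⟩ := hω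
  set c := nearest b z ω with hc
  set T := ∑' i, if i = c then 0 else dist (b i ω) z ^ (-α) * h i ω with hT
  have hterm : ∀ i, 0 < dist (b i ω) z ^ (-α) * h i ω := fun i =>
    mul_pos (Real.rpow_pos_of_pos (hd i) _) (hpos i)
  have hTpos : 0 < T := by
    have hs : Summable fun i => if i = c then 0 else dist (b i ω) z ^ (-α) * h i ω :=
      Summable.of_nonneg_of_le (fun i => by split_ifs; exacts [le_rfl, (hterm i).le])
        (fun i => by split_ifs; exacts [(hterm i).le, le_rfl]) hsum
    -- The index c + 1 is a witness different from c. It makes the interference positive, so the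
    -- denominator is positive even without noise.
    refine hs.tsum_pos (fun i => by split_ifs; exacts [le_rfl, (hterm i).le]) (c + 1) ?_
    rw [if_neg (Nat.succ_ne_self c)]
    exact hterm _
  have hI : interference b h P α z ω = P * T := by
    rw [interference, hT, ← tsum_mul_left]
    refine tsum_congr fun i => ?_
    split_ifs <;> ring
  have hrel : relInterference b h α z ω = nearestDist b z ω ^ α * T := by
    rw [relInterference, hT, ← tsum_mul_left]
    refine tsum_congr fun i => ?_
    split_ifs <;> ring
  have hR : 0 < nearestDist b z ω := hd _
  have hg : 0 < nearestGain b h z ω := hpos _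
  have hRa := Real.rpow_pos_of_pos hR α
  have hden : 0 < P * T + σ ^ 2 := by positivity
  refine ⟨hR, hg, ?_, fun β => ?_⟩
  · rw [sinr, hI]
    have := Real.rpow_pos_of_pos hR (-α)
    positivity
  · rw [sinr, hI, hrel, lt_div_iff₀ hden, Real.rpow_neg hR.le, ← div_eq_mul_inv, lt_div_iff₀ hRa]
    have e : β / P * nearestDist b z ω ^ α * σ ^ 2 + β * (nearestDist b z ω ^ α * T) =
        β * (P * T + σ ^ 2) * nearestDist b z ω ^ α / P := by
      field_simp; ring
    rw [e, div_lt_iff₀ hP, mul_comm P (nearestGain b h z ω)]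

theorem measure_nearestDist_inter_sinr (hlam : 0 < lam) (hP : 0 < P) (hα : 2 < α)
    (hb : IsPoissonProcess b lam μ) (hh : IsRayleighFading h b μ) (σ : ℝ) (z : Plane) {β : ℝ}
    (hβ : 0 ≤ β) {A : Set ℝ} (hA : MeasurableSet A) :
    μ (nearestDist b z ⁻¹' A ∩ sinr b h P α σ z ⁻¹' Ioi β) =
      ∫⁻ r in A ∩ Ioi 0, ENNReal.ofReal (2 * Real.pi * lam * r *
        Real.exp (-(β / P * r ^ α * σ ^ 2)) *
        Real.exp (-(Real.pi * lam * r ^ 2 * (1 + decayRate β (α / 2))))) := by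
  rw [← measure_nearestDist_inter_lt_gain hlam hα hb hh z hβ
    (τ := fun r => β / P * r ^ α * σ ^ 2) (by fun_prop)
    (fun r hr => by have := Real.rpow_pos_of_pos hr α; positivity) hA]
  refine measure_congr ?_
  filter_upwards [ae_sinr_regular hlam hP hα hb hh σ z] with ω hω
  exact propext (and_congr Iff.rfl (hω.2.2.2 β))

/-- The case β = 0, τ = 0 of the joint law: the remaining event says that the gain is positive,
which is almost sure. -/
theorem map_nearestDist (hlam : 0 < lam) (hα : 2 < α)
    (hb : IsPoissonProcess b lam μ) (hh : IsRayleighFading h b μ) (z : Plane) :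
    μ.map (nearestDist b z) = (volume.restrict (Ioi 0)).withDensity fun r =>
      ENNReal.ofReal (2 * Real.pi * lam * r * Real.exp (-(Real.pi * lam * r ^ 2))) := by
  ext A hA
  have h1 := measure_nearestDist_inter_lt_gain hlam hα hb hh z le_rfl
    (τ := fun _ => 0) (by fun_prop) (fun r hr => le_rfl) hA
  simp only [neg_zero, Real.exp_zero, mul_one, decayRate_zero, add_zero] at h1
  rw [Measure.map_apply (measurable_nearestDist hb.measurable z) hA, withDensity_apply _ hA,
    Measure.restrict_restrict hA, ← h1]
  refine measure_congr ?_
  filter_upwards [ae_gain_pos hh.hasLaw] with ω hω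
  exact propext ⟨fun hx => ⟨hx, by simpa [nearestGain] using hω _⟩, fun hx => hx.1⟩

/-- Cellular mode ignores interference, so it is the case β = 0 with τ(r) = γ r^α / (kP). -/
theorem map_restrict_cellularMode (hlam : 0 < lam) (hP : 0 < P) (hα : 2 < α)
    (hk : 0 < k) (hγ : 0 ≤ γ) (hb : IsPoissonProcess b lam μ) (hh : IsRayleighFading h b μ)
    (z : Plane) :
    (μ.restrict (cellularMode b h P α k γ z)).map (nearestDist b z) =
      (volume.restrict (Ioi 0)).withDensity fun r => ENNReal.ofReal (2 * Real.pi * lam *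
        (r * Real.exp (-(Real.pi * lam * r ^ 2) - γ * r ^ α / (k * P)))) := by
  ext A hA
  have h1 := measure_nearestDist_inter_lt_gain hlam hα hb hh z le_rfl
    (τ := fun r => γ * r ^ α / (k * P)) (by fun_prop)
    (fun r hr => by have := Real.rpow_pos_of_pos hr α; positivity) hA
  have hR := measurable_nearestDist hb.measurable z
  rw [Measure.map_apply hR hA, withDensity_apply _ hA, Measure.restrict_restrict hA,
    Measure.restrict_apply (hR hA)]
  have h2 : ∀ r, 2 * Real.pi * lam * r * Real.exp (-(γ * r ^ α / (k * P))) *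
      Real.exp (-(Real.pi * lam * r ^ 2 * (1 + decayRate 0 (α / 2)))) =
      2 * Real.pi * lam * (r * Real.exp (-(Real.pi * lam * r ^ 2) - γ * r ^ α / (k * P))) := by
    intro r
    rw [decayRate_zero, mul_assoc (2 * Real.pi * lam * r), ← Real.exp_add]
    ring_nf
  simp_rw [h2] at h1
  rw [← h1]
  refine measure_congr ?_
  -- The noise level 0 is a dummy; only positivity of the nearest distance is needed.
  filter_upwards [ae_sinr_regular hlam hP hα hb hh 0 z] with ω hω
  refine propext (and_congr Iff.rfl ?_)
  have hRa := Real.rpow_pos_of_pos hω.1 α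
  change γ < k * P * nearestGain b h z ω * nearestDist b z ω ^ (-α) ↔
    γ * nearestDist b z ω ^ α / (k * P) + 0 * relInterference b h α z ω < nearestGain b h z ω
  rw [Real.rpow_neg hω.1.le, ← div_eq_mul_inv, lt_div_iff₀ hRa, zero_mul, add_zero,
    div_lt_iff₀ (by positivity), mul_comm (nearestGain b h z ω)]

instance isMarkovKernel_sinrLawAt : IsMarkovKernel (sinrLawAt b h P α σ z μ) := by
  unfold sinrLawAt; infer_instance

/-- Both sides have the same integral over every measurable set of distances, by the joint law. The
exceptional null set of distances may depend on t. -/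
theorem ae_sinrLawAt_tail (hlam : 0 < lam) (hP : 0 < P) (hα : 2 < α)
    (hb : IsPoissonProcess b lam μ) (hh : IsRayleighFading h b μ) (σ : ℝ) (z : Plane) {t : ℝ}
    (ht : 0 < t) :
    ∀ᵐ x ∂(μ.map (nearestDist b z)), sinrLawAt b h P α σ z μ x (Ioi (Real.exp t - 1)) =
      ENNReal.ofReal (coverage lam P α σ x t) := by
  have hR := measurable_nearestDist hb.measurable z
  have hS := measurable_sinr hb.measurable hh.measurable P α σ z
  have hβ : 0 ≤ Real.exp t - 1 := by linarith [Real.add_one_le_exp t]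
  have hcm : Measurable fun x => ENNReal.ofReal (coverage lam P α σ x t) :=
    ((measurable_coverage lam P α σ).comp (measurable_id.prodMk measurable_const)).ennreal_ofReal
  have := Measure.isProbabilityMeasure_map (μ := μ) hR.aemeasurable
  refine ae_eq_of_forall_setLIntegral_eq_of_sigmaFinite
    (Kernel.measurable_coe _ measurableSet_Ioi) hcm fun A hA _ => ?_
  rw [setLIntegral_map hA (Kernel.measurable_coe _ measurableSet_Ioi) hR, sinrLawAt,
    setLIntegral_preimage_condDistrib hR hS.aemeasurable measurableSet_Ioi hA,
    measure_nearestDist_inter_sinr hlam hP hα hb hh σ z hβ hA, map_nearestDist hlam hα hb hh z,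
    setLIntegral_withDensity_eq_setLIntegral_mul _ (by fun_prop) hcm hA,
    Measure.restrict_restrict hA]
  refine setLIntegral_congr_fun (hA.inter measurableSet_Ioi) fun r hr => ?_
  have hr' : 0 < r := hr.2
  simp only [Pi.mul_apply]
  rw [← ENNReal.ofReal_mul (by positivity), coverage]
  congr 1
  have : Real.exp (-(Real.pi * lam * r ^ 2 * (1 + decayRate (Real.exp t - 1) (α / 2)))) =
      Real.exp (-(Real.pi * lam * r ^ 2)) *
        Real.exp (-(Real.pi * lam * r ^ 2 * decayRate (Real.exp t - 1) (α / 2))) := by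
    rw [← Real.exp_add]; ring_nf
  rw [this]
  ring

theorem ae_sinrLawAt_nonneg (hlam : 0 < lam) (hP : 0 < P) (hα : 2 < α)
    (hb : IsPoissonProcess b lam μ) (hh : IsRayleighFading h b μ) (σ : ℝ) (z : Plane) :
    ∀ᵐ x ∂(μ.map (nearestDist b z)), ∀ᵐ s ∂(sinrLawAt b h P α σ z μ x), 0 ≤ s := by
  have hR := measurable_nearestDist hb.measurable z
  have hS := measurable_sinr hb.measurable hh.measurable P α σ z
  refine Measure.ae_ae_of_ae_compProd (p := fun x : ℝ × ℝ => 0 ≤ x.2) ?_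
  rw [sinrLawAt, compProd_map_condDistrib hS.aemeasurable,
    ae_map_iff (hR.prodMk hS).aemeasurable (measurableSet_le measurable_const measurable_snd)]
  filter_upwards [ae_sinr_regular hlam hP hα hb hh σ z] with ω hω using hω.2.2.1

end

section

variable {Ω : Type*} [MeasurableSpace Ω] {b : ℕ → Ω → Plane} {h : ℕ → Ω → ℝ}
  {μ : Measure Ω} {lam P α k γ : ℝ}

/-- The conditional law of the rate given the distance to the nearest station. -/
theorem ae_sinrLawAt_log_tail [IsProbabilityMeasure μ] (hlam : 0 < lam) (hP : 0 < P) (hα : 2 < α)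
    (hb : IsPoissonProcess b lam μ) (hh : IsRayleighFading h b μ) (σ : ℝ) (z : Plane) :
    ∀ᵐ x ∂(μ.map (nearestDist b z)), ∀ᵐ t ∂(volume.restrict (Ioi (0 : ℝ))),
      sinrLawAt b h P α σ z μ x {s | t < Real.log (1 + s)} =
        ENNReal.ofReal (coverage lam P α σ x t) := by
  have hR := measurable_nearestDist hb.measurable z
  have := Measure.isProbabilityMeasure_map (μ := μ) hR.aemeasurable
  set κ := sinrLawAt b h P α σ z μ with hκ
  have hm1 : Measurable fun p : ℝ × ℝ => κ p.1 (Ioi (Real.exp p.2 - 1)) := by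
    have ht : MeasurableSet {q : (ℝ × ℝ) × ℝ | Real.exp q.1.2 - 1 < q.2} :=
      measurableSet_lt (by fun_prop) (by fun_prop)
    exact Kernel.measurable_kernel_prodMk_left (κ := κ.comap Prod.fst measurable_fst) ht
  have h1 : ∀ᵐ x ∂(μ.map (nearestDist b z)), ∀ᵐ t ∂(volume.restrict (Ioi (0 : ℝ))),
      κ x (Ioi (Real.exp t - 1)) = ENNReal.ofReal (coverage lam P α σ x t) := by
    -- Joint measurability allows the quantifiers to be exchanged, which replaces the null sets
    -- depending on t by a single null set of distances.
    rw [Measure.ae_ae_comm (p := fun x t => κ x (Ioi (Real.exp t - 1)) =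
      ENNReal.ofReal (coverage lam P α σ x t))
      (measurableSet_eq_fun hm1 (measurable_coverage lam P α σ).ennreal_ofReal)]
    filter_upwards [self_mem_ae_restrict measurableSet_Ioi] with t ht
    exact ae_sinrLawAt_tail hlam hP hα hb hh σ z ht
  filter_upwards [h1, ae_sinrLawAt_nonneg hlam hP hα hb hh σ z] with x hx hnn
  filter_upwards [hx] with t ht
  rw [← ht]
  refine measure_congr ?_
  filter_upwards [hnn] with s hs
  refine propext ?_
  change t < Real.log (1 + s) ↔ Real.exp t - 1 < s
  rw [Real.lt_log_iff_exp_lt (by linarith), sub_lt_iff_lt_add']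

/-! ### Conditioning on cellular mode. -/

theorem servingDistLaw_eq [IsProbabilityMeasure μ] (hlam : 0 < lam) (hP : 0 < P) (hα : 2 < α)
    (hk : 0 < k) (hγ : 0 ≤ γ) (hb : IsPoissonProcess b lam μ) (hh : IsRayleighFading h b μ)
    (z : Plane) :
    servingDistLaw b h P α k γ z μ = (μ (cellularMode b h P α k γ z))⁻¹ •
      (volume.restrict (Ioi 0)).withDensity fun r => ENNReal.ofReal (2 * Real.pi * lam *
        (r * Real.exp (-(Real.pi * lam * r ^ 2) - γ * r ^ α / (k * P)))) := by
  rw [servingDistLaw, ProbabilityTheory.cond, Measure.map_smul,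
    map_restrict_cellularMode hlam hP hα hk hγ hb hh z]

theorem measure_cellularMode [IsProbabilityMeasure μ] (hlam : 0 < lam) (hP : 0 < P) (hα : 2 < α)
    (hk : 0 < k) (hγ : 0 ≤ γ) (hb : IsPoissonProcess b lam μ) (hh : IsRayleighFading h b μ)
    (z : Plane) :
    μ (cellularMode b h P α k γ z) = ∫⁻ r in Ioi 0, ENNReal.ofReal (2 * Real.pi * lam *
        (r * Real.exp (-(Real.pi * lam * r ^ 2) - γ * r ^ α / (k * P)))) := by
  have h1 := congrArg (fun ν : Measure ℝ => ν univ)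
    (map_restrict_cellularMode hlam hP hα hk hγ hb hh z)
  simpa [Measure.map_apply (measurable_nearestDist hb.measurable z) MeasurableSet.univ,
    withDensity_apply] using h1

theorem measure_cellularMode_ne_zero [IsProbabilityMeasure μ] (hlam : 0 < lam) (hP : 0 < P)
    (hα : 2 < α) (hk : 0 < k) (hγ : 0 ≤ γ) (hb : IsPoissonProcess b lam μ) (hh : IsRayleighFading h b μ)
    (z : Plane) :
    μ (cellularMode b h P α k γ z) ≠ 0 := by
  rw [measure_cellularMode hlam hP hα hk hγ hb hh z, ← pos_iff_ne_zero,
    setLIntegral_pos_iff (by fun_prop)]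
  refine lt_of_lt_of_le (b := volume (Ioi (0 : ℝ))) (by simp) (measure_mono fun r hr => ⟨?_, hr⟩)
  have hr' : 0 < r := hr
  have : 0 < 2 * Real.pi * lam *
      (r * Real.exp (-(Real.pi * lam * r ^ 2) - γ * r ^ α / (k * P))) := by positivity
  simpa [Function.mem_support] using this

/-- Conditioning on the mode gives an absolutely continuous law of the distance, so facts about the
unconditioned kernel hold for almost every serving distance. -/
theorem ae_servingDistLaw {p : ℝ → Prop} (hb : IsPoissonProcess b lam μ) {z : Plane}
    (hp : ∀ᵐ x ∂(μ.map (nearestDist b z)), p x) :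
    ∀ᵐ x ∂(servingDistLaw b h P α k γ z μ), p x :=
  (cond_absolutelyContinuous.map (measurable_nearestDist hb.measurable z)).ae_le hp

end

end CellularD2D

/-! ### Assembly of the average rate. -/

open CellularD2D in
theorem proposition2 {Ω : Type*} [MeasurableSpace Ω] (μ : Measure Ω) [IsProbabilityMeasure μ]
    (b : ℕ → Ω → CellularD2D.Plane) (h : ℕ → Ω → ℝ) (z : CellularD2D.Plane)
    (lam P α σ k γ : ℝ) (hlam : 0 < lam) (hP : 0 < P) (hα : 2 < α) (hk : 0 < k) (hγ : 0 ≤ γ)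
    (hb : CellularD2D.IsPoissonProcess b lam μ)
    (hh : CellularD2D.IsRayleighFading h b μ) :
    -- the association probability
    μ.real (CellularD2D.cellularMode b h P α k γ z) =
        2 * Real.pi * lam * ∫ r in Ioi (0 : ℝ),
          Real.exp (-(γ * (k * P)⁻¹ * r ^ α) - Real.pi * lam * r ^ 2) * r ∧
    -- the two expectations in the average rate, and the double integral below, converge
    Integrable (fun p : ℝ × ℝ => Real.log (1 + p.2))
      (CellularD2D.servingDistLaw b h P α k γ z μ ⊗ₘ CellularD2D.sinrLawAt b h P α σ z μ) ∧
    IntegrableOn (fun p : ℝ × ℝ =>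
        p.1 * Real.exp (-(Real.pi * lam * p.1 ^ 2) - γ * p.1 ^ α / (k * P)) *
          (Real.exp (-((Real.exp p.2 - 1) / P * p.1 ^ α * σ ^ 2)) *
            Real.exp (-(2 * Real.pi * lam * ((Real.exp p.2 - 1) / p.1 ^ (-α)) ^ (2 / α) *
              CellularD2D.L (Real.exp p.2 - 1) α))))
      (Ioi (0 : ℝ) ×ˢ Ioi (0 : ℝ)) ∧
    -- the average rate
    CellularD2D.averageRate b h P α σ k γ z μ =
      ∫ x, (∫ t in Ioi (0 : ℝ),
          (CellularD2D.sinrLawAt b h P α σ z μ x).real {s | t < Real.log (1 + s)})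
        ∂(CellularD2D.servingDistLaw b h P α k γ z μ) ∧
    CellularD2D.averageRate b h P α σ k γ z μ =
      2 * Real.pi * lam / μ.real (CellularD2D.cellularMode b h P α k γ z) *
        ∫ r in Ioi (0 : ℝ),
          r * Real.exp (-(Real.pi * lam * r ^ 2) - γ * r ^ α / (k * P)) *
            ∫ t in Ioi (0 : ℝ),
              Real.exp (-((Real.exp t - 1) / P * r ^ α * σ ^ 2)) *
                Real.exp (-(2 * Real.pi * lam * ((Real.exp t - 1) / r ^ (-α)) ^ (2 / α) *
                  CellularD2D.L (Real.exp t - 1) α)) := by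
  set S := servingDistLaw b h P α k γ z μ with hS
  set κ := sinrLawAt b h P α σ z μ with hκ
  set m := cellularMode b h P α k γ z with hm
  set d : ℝ → ℝ := fun r => r * Real.exp (-(Real.pi * lam * r ^ 2) - γ * r ^ α / (k * P)) with hd
  have hdm : Measurable d := by fun_prop
  have hd0 : ∀ r ∈ Ioi (0 : ℝ), 0 ≤ d r := fun r hr => mul_nonneg (le_of_lt hr) (Real.exp_pos _).le
  have hcd : 0 < 2 * Real.pi * lam := by positivity
  have hSeq : S = (μ m)⁻¹ • (volume.restrict (Ioi 0)).withDensity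
      fun r => ENNReal.ofReal (2 * Real.pi * lam * d r) :=
    servingDistLaw_eq hlam hP hα hk hγ hb hh z
  have hmne : μ m ≠ 0 := measure_cellularMode_ne_zero hlam hP hα hk hγ hb hh z
  have hSprob : IsProbabilityMeasure S := by
    have := cond_isProbabilityMeasure hmne
    exact Measure.isProbabilityMeasure_map (measurable_nearestDist hb.measurable z).aemeasurable
  have htail : ∀ᵐ x ∂S, ∀ᵐ t ∂(volume.restrict (Ioi (0 : ℝ))),
      κ x {s | t < Real.log (1 + s)} = ENNReal.ofReal (coverage lam P α σ x t) :=
    ae_servingDistLaw hb (ae_sinrLawAt_log_tail hlam hP hα hb hh σ z)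
  have hnn : ∀ᵐ x ∂S, 0 ≤ᵐ[κ x] fun s => Real.log (1 + s) := by
    filter_upwards [ae_servingDistLaw (h := h) (P := P) (α := α) (k := k) (γ := γ) hb
      (ae_sinrLawAt_nonneg hlam hP hα hb hh σ z)] with x hx
    filter_upwards [hx] with s hs
    exact Real.log_nonneg (by linarith)
  have hw0 : ∀ r : ℝ, 0 < r → 0 ≤ γ * r ^ α / (k * P) := fun r hr => by
    have := Real.rpow_pos_of_pos hr α
    positivity
  have hfin : ∫⁻ p in Ioi (0 : ℝ) ×ˢ Ioi (0 : ℝ),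
      ENNReal.ofReal (d p.1 * coverage lam P α σ p.1 p.2) < ⊤ :=
    lintegral_coverage_lt_top hlam hP hα (w := fun r => γ * r ^ α / (k * P)) (by fun_prop) hw0
  have hcm := measurable_coverage lam P α σ
  have hGm : Measurable fun p : ℝ × ℝ => d p.1 * coverage lam P α σ p.1 p.2 := by fun_prop
  have hlogm : Measurable fun p : ℝ × ℝ => Real.log (1 + p.2) := by fun_prop
  have hint : Integrable (fun p : ℝ × ℝ => Real.log (1 + p.2)) (S ⊗ₘ κ) := by
    refine ⟨hlogm.aestronglyMeasurable, ?_⟩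
    rw [hasFiniteIntegral_iff_enorm, Measure.lintegral_compProd hlogm.enorm]
    -- The layer cake formula for extended nonnegative integrals, which needs no integrability and
    -- thus serves to prove it.
    have h1 : ∀ᵐ x ∂S, ∫⁻ s, ‖Real.log (1 + s)‖ₑ ∂(κ x) =
        ∫⁻ t in Ioi (0 : ℝ), ENNReal.ofReal (coverage lam P α σ x t) := by
      filter_upwards [htail, hnn] with x hx hx0
      rw [← lintegral_congr_ae hx, ← lintegral_eq_lintegral_meas_lt _ hx0 (by fun_prop)]
      refine lintegral_congr_ae ?_
      filter_upwards [hx0] with s hs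
      exact Real.enorm_of_nonneg hs
    have hFm : Measurable fun x => ∫⁻ t in Ioi (0 : ℝ), ENNReal.ofReal (coverage lam P α σ x t) :=
      hcm.ennreal_ofReal.lintegral_prod_right'
    rw [lintegral_congr_ae h1, hSeq, lintegral_smul_measure,
      lintegral_withDensity_eq_lintegral_mul _ (by fun_prop) hFm]
    refine ENNReal.mul_lt_top (ENNReal.inv_lt_top.2 (pos_iff_ne_zero.2 hmne)) ?_
    have h2 : ∫⁻ r in Ioi (0 : ℝ), ((fun r => ENNReal.ofReal (2 * Real.pi * lam * d r)) *
        fun x => ∫⁻ t in Ioi (0 : ℝ), ENNReal.ofReal (coverage lam P α σ x t)) r =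
        ENNReal.ofReal (2 * Real.pi * lam) * ∫⁻ p in Ioi (0 : ℝ) ×ˢ Ioi (0 : ℝ),
          ENNReal.ofReal (d p.1 * coverage lam P α σ p.1 p.2) := by
      rw [Measure.volume_eq_prod, ← Measure.prod_restrict,
        lintegral_prod _ hGm.ennreal_ofReal.aemeasurable,
        ← lintegral_const_mul' _ _ ENNReal.ofReal_ne_top]
      refine setLIntegral_congr_fun measurableSet_Ioi fun r hr => ?_
      simp only [Pi.mul_apply]
      simp_rw [ENNReal.ofReal_mul (hd0 r hr)]
      rw [lintegral_const_mul' _ _ ENNReal.ofReal_ne_top, ENNReal.ofReal_mul hcd.le, mul_assoc]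
    rw [h2]
    exact ENNReal.mul_lt_top ENNReal.ofReal_lt_top hfin
  have hrate : averageRate b h P α σ k γ z μ =
      ∫ x, (∫ t in Ioi (0 : ℝ), (κ x).real {s | t < Real.log (1 + s)}) ∂S := by
    refine integral_congr_ae ?_
    -- Joint integrability makes the rate integrable at almost every distance, as the real-valued
    -- layer cake formula requires.
    filter_upwards [((Measure.integrable_compProd_iff hint.aestronglyMeasurable).1 hint).1, hnn]
      with x hx hx0
    exact hx.integral_eq_integral_meas_lt hx0
  refine ⟨?_, hint, ?_, hrate, ?_⟩
  · have h1 : μ m = ∫⁻ r in Ioi 0, ENNReal.ofReal (2 * Real.pi * lam * d r) :=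
      measure_cellularMode hlam hP hα hk hγ hb hh z
    rw [measureReal_def, h1, ← integral_const_mul, integral_eq_lintegral_of_nonneg_ae]
    · congr 1
      refine setLIntegral_congr_fun measurableSet_Ioi fun r _ => ?_
      simp only [hd]
      congr 2
      rw [mul_comm]
      congr 2
      rw [div_eq_mul_inv]
      ring
    · filter_upwards [self_mem_ae_restrict measurableSet_Ioi] with r hr
      have hr' : 0 < r := hr
      simp only [Pi.zero_apply]
      positivity
    · exact Measurable.aestronglyMeasurable (by fun_prop)
  · have hG : IntegrableOn (fun p : ℝ × ℝ => d p.1 * coverage lam P α σ p.1 p.2)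
        (Ioi (0 : ℝ) ×ˢ Ioi (0 : ℝ)) := by
      refine ⟨hGm.aestronglyMeasurable, ?_⟩
      rw [hasFiniteIntegral_iff_ofReal]
      · exact hfin
      · filter_upwards [self_mem_ae_restrict (measurableSet_Ioi.prod measurableSet_Ioi)] with p hp
        exact mul_nonneg (hd0 _ hp.1) (coverage_pos _ _ _ _ _ _).le
    refine hG.congr_fun (fun p hp => ?_) (measurableSet_Ioi.prod measurableSet_Ioi)
    simp only [hd]
    rw [coverage_eq (by linarith) hp.1 hp.2]
  · have h1 : ∀ᵐ x ∂S, ∫ t in Ioi (0 : ℝ), (κ x).real {s | t < Real.log (1 + s)} =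
        ∫ t in Ioi (0 : ℝ), coverage lam P α σ x t := by
      filter_upwards [htail] with x hx
      refine integral_congr_ae ?_
      filter_upwards [hx] with t ht
      rw [measureReal_def, ht, ENNReal.toReal_ofReal (coverage_pos _ _ _ _ _ _).le]
    rw [hrate, integral_congr_ae h1, hSeq, integral_smul_measure,
      integral_withDensity_eq_integral_toReal_smul (by fun_prop)
        (Filter.Eventually.of_forall fun _ => ENNReal.ofReal_lt_top), smul_eq_mul,
      ENNReal.toReal_inv, ← measureReal_def]
    have h2 : ∀ r ∈ Ioi (0 : ℝ), (ENNReal.ofReal (2 * Real.pi * lam * d r)).toReal •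
        (∫ t in Ioi (0 : ℝ), coverage lam P α σ r t) =
        2 * Real.pi * lam * (d r * ∫ t in Ioi (0 : ℝ),
          Real.exp (-((Real.exp t - 1) / P * r ^ α * σ ^ 2)) *
            Real.exp (-(2 * Real.pi * lam * ((Real.exp t - 1) / r ^ (-α)) ^ (2 / α) *
              L (Real.exp t - 1) α))) := by
      intro r hr
      rw [ENNReal.toReal_ofReal (mul_nonneg hcd.le (hd0 r hr)), smul_eq_mul, mul_assoc]
      exact congrArg (fun y => 2 * Real.pi * lam * (d r * y))
        (setIntegral_congr_fun measurableSet_Ioi fun t ht => coverage_eq (by linarith) hr ht)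
    rw [setIntegral_congr_fun measurableSet_Ioi h2, integral_const_mul, ← mul_assoc,
      inv_mul_eq_div]
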